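/- Digraphs have no loops and are connected and infinite. For a vertex $u$ of a digraph $D$, $\mathrm{desc}(u)$ is the set of vertices reachable from $u$ by a directed path, and $\mathrm{desc}(X)=\bigcup_{u\in X}\mathrm{desc}(u)$. $D$ is \emph{distance-transitive} if for every $s\ge 0$ its automorphism group is transitive on the pairs $(u,v)$ for which there is an $s$-arc from $u$ to $v$ but no $t$-arc with $t<s$. $D$ is \emph{weakly descendant-homogeneous} if it is vertex transitive and for all finite sets $X,Y$ of vertices and every isomorphism $f$ between the induced subdigraphs on $\mathrm{desc}(X)$ and $\mathrm{desc}(Y)$ some automorphism of $D$ agrees with $f$ on $X$. Two edges are related by the \emph{reachability relation} if some alternating walk starts with one and ends with the other; an \emph{alternet} is the subdigraph spanned by a reachability class. $\delta$ is the relation of having the same set of out-neighbours; it is non-trivial if it is not equality. In a quotient $D/\rho$, $(A,B)$ is an edge if some $a\in A$, $b\in B$ form an edge $(a,b)$ of $D$. $\mathcal C$ is the class of edge-transitive bipartite digraphs with finite non-empty parts $X,Y$, all edges directed from $X$ to $Y$, no isolated vertices, such that $\delta$ is non-trivial on $X$ and every $\delta$-class in $X$ has exactly $|Y|$ elements. Let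 $m\ge 1$ and let $\Omega$ be a set of cardinality $M$, where $M\ge m$ is an integer or $M=\aleph_0$. $D(m,M)$ is the digraph constructed as follows. Take an infinite directed tree $T$ of out-valency $1$ whose in-valency is the number of $m$-element subsets of $\Omega$ and, for each $t\in T$, a bijection between the in-neighbours of $t$ and the $m$-element subsets of $\Omega$. The vertex set is $T\times\Omega$ and the edges are the pairs $((s,c),(t,a))$ with $(s,t)$ an edge of $T$, $c\in\Omega$, and $a$ in the $m$-element subset that corresponds to $s$. For $m>1$ all alternets of $D(m,M)$ are isomorphic to the bipartite digraph $\Sigma(m,M)$ whose sources are the pairs $(S,c)$ with $S\subseteq\Omega$, $|S|=m$, $c\in\Omega$, whose sinks are the elements of $\Omega$, and in which the out-neighbours of $(S,c)$ are the elements of $S$. \textbf{Theorem.} Let $D$ be a distance-transitive, weakly descendant-homogeneous digraph of finite out-valency $m>1$ with no directed cycles, and suppose that its reachability relation is not universal. (1) If the alternets of $D$ belong to $\mathcal C$, then $\delta$ is non-trivial on $D$, and $D/\delta$ is a directed tree of out-valency $1$ and in-valency $k$, where $k$ is the number of $\delta$-classes of sources in an alternet. (2) If the alternets of $D$ are isomorphic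 to $\Sigma(m,M)$ for some integer $M\ge m$ or $M=\aleph_0$, then $D$ is isomorphic to $D(m,M)$ (for every choice of the tree and of the bijections). -/

import Mathlib

universe u v w

namespace Digraph

section Basic

variable {V : Type u} {W : Type v}

/-- Isomorphisms of digraphs. -/
abbrev Iso (D : Digraph V) (E : Digraph W) := D.Adj ≃r E.Adj

/-- Automorphisms of a digraph. -/
abbrev Aut (D : Digraph V) := D.Iso D

/-- The set of out-neighbours of a vertex. -/
def outSet (D : Digraph V) (x : V) : Set V := {y | D.Adj x y}

/-- The set of in-neighbours of a vertex. -/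
def inSet (D : Digraph V) (x : V) : Set V := {y | D.Adj y x}

/-- The full induced subdigraph on a set of vertices. -/
def inducedOn (D : Digraph V) (S : Set V) : Digraph S where
  Adj a b := D.Adj a b

/-- Connectedness of the underlying undirected graph. -/
def IsConnected (D : Digraph V) : Prop := D.toSimpleGraphInclusive.Connected

/-- No directed cycles, of any length (loops and cycles of length two are excluded as well):
no vertex is reached from itself by a directed walk of positive length. -/
def NoDirectedCycles (D : Digraph V) : Prop := ∀ x, ¬ Relation.TransGen D.Adj x x

/-- `D.HasArc s x y`: there is an `s`-arc from `x` to `y`. -/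
def HasArc (D : Digraph V) (s : ℕ) (x y : V) : Prop :=
  ∃ p : ℕ → V, p 0 = x ∧ p s = y ∧ (∀ i, i < s → D.Adj (p i) (p (i + 1))) ∧
    (∀ i, i + 1 < s → p i ≠ p (i + 2))

/-- The descendant set of a vertex. -/
def desc (D : Digraph V) (x : V) : Set V := {y | ∃ s, D.HasArc s x y}

/-- The descendant set of a set of vertices. -/
def descSet (D : Digraph V) (X : Set V) : Set V := ⋃ x ∈ X, D.desc x

def IsVertexTransitive (D : Digraph V) : Prop := ∀ x y : V, ∃ g : D.Aut, g x = y

def IsEdgeTransitive (D : Digraph V) : Prop :=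
  ∀ a b c d : V, D.Adj a b → D.Adj c d → ∃ g : D.Aut, g a = c ∧ g b = d

/-- There is an `s`-arc from `x` to `y`, but no shorter arc. -/
def AtDistance (D : Digraph V) (s : ℕ) (x y : V) : Prop :=
  D.HasArc s x y ∧ ∀ t, t < s → ¬ D.HasArc t x y

/-- For each `s`, the automorphism group is transitive on the pairs at (directed) distance `s`. -/
def IsDistanceTransitive (D : Digraph V) : Prop :=
  ∀ (s : ℕ) (a b c d : V), D.AtDistance s a b → D.AtDistance s c d →
    ∃ g : D.Aut, g a = c ∧ g b = d

/-- Vertex transitivity, and for every isomorphism `f` between the subdigraphs induced on the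
descendant sets of finite sets `X` and `Y` there is an automorphism that agrees with `f` on `X`. -/
def IsWeaklyDescendantHomogeneous (D : Digraph V) : Prop :=
  D.IsVertexTransitive ∧
  ∀ X Y : Set V, X.Finite → Y.Finite →
    ∀ f : (D.inducedOn (D.descSet X)).Iso (D.inducedOn (D.descSet Y)),
      ∃ g : D.Aut, ∀ (x : V) (hx : x ∈ D.descSet X), x ∈ X → g x = (f ⟨x, hx⟩ : V)

/-- `x 0, …, x n` is an alternating walk: consecutive edges have opposite directions. -/
def IsAlternatingWalk (D : Digraph V) (n : ℕ) (x : ℕ → V) : Prop :=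
  (∀ i, i < n → (Even i → D.Adj (x i) (x (i + 1))) ∧ (Odd i → D.Adj (x (i + 1)) (x i))) ∨
  (∀ i, i < n → (Odd i → D.Adj (x i) (x (i + 1))) ∧ (Even i → D.Adj (x (i + 1)) (x i)))

/-- The edge `e'` is reachable from the edge `e` by an alternating walk. -/
def EdgeReachable (D : Digraph V) (e e' : V × V) : Prop :=
  D.Adj e.1 e.2 ∧ D.Adj e'.1 e'.2 ∧
  ∃ (n : ℕ) (x : ℕ → V), D.IsAlternatingWalk (n + 1) x ∧ e = (x 0, x 1) ∧
    (e' = (x n, x (n + 1)) ∨ e' = (x (n + 1), x n))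

/-- Any two edges are reachable from each other. -/
def ReachabilityUniversal (D : Digraph V) : Prop :=
  ∀ e e' : V × V, D.Adj e.1 e.2 → D.Adj e'.1 e'.2 → D.EdgeReachable e e'

/-- The vertices incident with an edge in the reachability class of the edge `e`. -/
def alternetVertices (D : Digraph V) (e : V × V) : Set V :=
  {x | ∃ e', D.EdgeReachable e e' ∧ (x = e'.1 ∨ x = e'.2)}

/-- The alternet of the edge `e`: the subdigraph spanned by the reachability class of `e`. -/
def alternet (D : Digraph V) (e : V × V) : Digraph (D.alternetVertices e) where
  Adj a b := D.EdgeReachable e ((a : V), (b : V))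

/-- The relation `δ`: to have the same set of out-neighbours. -/
def delta (D : Digraph V) : Setoid V where
  r x y := D.outSet x = D.outSet y
  iseqv := ⟨fun _ => rfl, fun h => h.symm, fun h h' => h.trans h'⟩

/-- The quotient digraph by an equivalence relation on the vertices. -/
def quotientBy (D : Digraph V) (r : Setoid V) : Digraph (Quotient r) where
  Adj A B := ∃ a b : V, Quotient.mk r a = A ∧ Quotient.mk r b = B ∧ D.Adj a b

/-- The sources of a digraph all of whose vertices are sources or sinks. -/
def sources (D : Digraph V) : Set V := {x | ∃ y, D.Adj x y}

/-- The number of `δ`-classes in the set of sources. -/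
noncomputable def numDeltaClasses (D : Digraph V) : ℕ∞ :=
  (Quotient.mk D.delta '' D.sources).encard

/-- The class `𝒞` of bipartite digraphs. -/
def InClassC (S : Digraph V) : Prop :=
  ∃ X Y : Set V, Disjoint X Y ∧ X ∪ Y = Set.univ ∧
    (∀ a b, S.Adj a b → a ∈ X ∧ b ∈ Y) ∧
    (∀ a, ∃ b, S.Adj a b ∨ S.Adj b a) ∧
    X.Finite ∧ X.Nonempty ∧ Y.Finite ∧ Y.Nonempty ∧
    S.IsEdgeTransitive ∧
    (∃ a ∈ X, ∃ b ∈ X, a ≠ b ∧ S.delta a b) ∧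
    (∀ a ∈ X, Y.encard = {b ∈ X | S.delta a b}.encard)

/-- A directed tree: there are no loops, no two edges join the same two vertices, and the
underlying undirected graph is a tree. -/
def IsDirectedTree (D : Digraph V) : Prop :=
  (∀ a, ¬ D.Adj a a) ∧ (∀ a b, D.Adj a b → ¬ D.Adj b a) ∧ D.toSimpleGraphInclusive.IsTree

end Basic

/-- The set `Ω`, countable of cardinality `M`, where `M = ⊤` stands for `ℵ₀`. -/
abbrev Omega (M : ℕ∞) : Type := {i : ℕ // (i : ℕ∞) < M}

/-- The `m`-element subsets of `Ω`. -/
abbrev Subsets (m : ℕ) (M : ℕ∞) : Type := {S : Finset (Omega M) // S.card = m}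

/-- The bipartite digraph `Σ(m, M)`: the sinks are the elements of `Ω`, the sources are the
pairs of an `m`-element subset `S` of `Ω` and an element `c` of `Ω`, and the out-neighbours of
`(S, c)` are the elements of `S`. -/
def SigmaDigraph (m : ℕ) (M : ℕ∞) : Digraph ((Subsets m M × Omega M) ⊕ Omega M) where
  Adj x y := ∃ (S : Subsets m M) (c a : Omega M), x = Sum.inl (S, c) ∧ y = Sum.inr a ∧ a ∈ S.1

/-- The choices in the construction of `D(m, M)`: a directed tree of out-valency one and, for
each vertex `t`, a bijection from the in-neighbours of `t` to the `m`-element subsets of `Ω`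
(which makes the in-valency `M.choose m` if `M` is finite, and `ℵ₀` if `M = ℵ₀` and `1 ≤ m`). -/
structure LabelledTree (m : ℕ) (M : ℕ∞) where
  Vertex : Type w
  tree : Digraph Vertex
  isTree : tree.IsDirectedTree
  out_valency : ∀ t, (tree.outSet t).encard = 1
  label : ∀ t, tree.inSet t ≃ Subsets m M

/-- The digraph `D(m, M)`, made from a labelled tree `L`: if `(s, t)` is an edge of the tree, the
out-neighbours of `(s, c)` are the `(t, a)` with `a` in the label of `s`. -/
def LabelledTree.toDigraph {m : ℕ} {M : ℕ∞} (L : LabelledTree.{w} m M) :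
    Digraph (L.Vertex × Omega M) where
  Adj x y := ∃ h : x.1 ∈ L.tree.inSet y.1, y.2 ∈ (L.label y.1 ⟨x.1, h⟩).1

/-- Vertices of the standard tree whose in-neighbours are labelled by `I`: an integer `n` and the
labels of an infinite directed path that starts at height `n`, which are `o` from some point on
(they are set to `o` below `n`). -/
structure StdTree (I : Type w) (o : I) where
  height : ℤ
  path : ℤ → I
  below : ∀ j, j < height → path j = o
  eventually_eq : ∃ N, ∀ j, N ≤ j → path j = o

section StdTree

variable {I : Type w} {o : I}

def stdTree (I : Type w) (o : I) : Digraph (StdTree I o) where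
  Adj p q := q.height = p.height + 1 ∧ ∀ j, q.height ≤ j → p.path j = q.path j

theorem StdTree.ext' {p q : StdTree I o} (h : p.height = q.height)
    (h' : ∀ j, p.height ≤ j → p.path j = q.path j) : p = q := by
  have : p.path = q.path := by
    funext j
    rcases lt_or_ge j p.height with hj | hj
    · rw [p.below j hj, q.below j (h ▸ hj)]
    · exact h' j hj
  cases p; cases q; simp_all

def StdTree.next (p : StdTree I o) : StdTree I o where
  height := p.height + 1
  path j := if j < p.height + 1 then o else p.path j
  below j hj := if_pos hj
  eventually_eq := by
    obtain ⟨N, hN⟩ := p.eventually_eq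
    refine ⟨N, fun j hj => ?_⟩
    split_ifs
    · rfl
    · exact hN j hj

theorem stdTree_adj_iff {p q : StdTree I o} : (stdTree I o).Adj p q ↔ q = p.next := by
  constructor
  · rintro ⟨h, h'⟩
    refine StdTree.ext' h fun j hj => ?_
    rw [← h' j hj]
    simp only [StdTree.next]
    rw [if_neg (by omega)]
  · rintro rfl
    refine ⟨rfl, fun j hj => ?_⟩
    simp only [StdTree.next] at hj ⊢
    rw [if_neg (by omega)]

theorem stdTree_outSet (p : StdTree I o) : (stdTree I o).outSet p = {p.next} := by
  ext q
  simp [outSet, stdTree_adj_iff]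

/-- The in-neighbour with a given label. -/
def StdTree.prev (q : StdTree I o) (i : I) : StdTree I o where
  height := q.height - 1
  path j := if j = q.height - 1 then i else q.path j
  below j hj := by rw [if_neg (by omega)]; exact q.below j (by omega)
  eventually_eq := by
    obtain ⟨N, hN⟩ := q.eventually_eq
    refine ⟨max N q.height, fun j hj => ?_⟩
    have h1 := le_trans (le_max_left _ _) hj
    have h2 := le_trans (le_max_right _ _) hj
    rw [if_neg (by omega)]
    exact hN j h1

def stdLabel (q : StdTree I o) : (stdTree I o).inSet q ≃ I where
  toFun p := p.1.path p.1.height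
  invFun i := ⟨q.prev i, by
    refine ⟨by simp [StdTree.prev], fun j hj => ?_⟩
    simp only [StdTree.prev]
    rw [if_neg (by omega)]⟩
  left_inv := by
    rintro ⟨p, h1, h2⟩
    refine Subtype.ext (StdTree.ext' ?_ fun j hj => ?_)
    · simp only [StdTree.prev]; omega
    · simp only [StdTree.prev] at hj ⊢
      split_ifs with h
      · congr 1; omega
      · exact (h2 j (by omega)).symm
  right_inv i := by simp [StdTree.prev]

theorem stdTree_reachable_iterate (p : StdTree I o) (n : ℕ) :
    (stdTree I o).toSimpleGraphInclusive.Reachable p (StdTree.next^[n] p) := by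
  induction n with
  | zero => exact SimpleGraph.Reachable.refl _
  | succ n ih =>
    refine ih.trans (SimpleGraph.Adj.reachable ?_)
    rw [Function.iterate_succ_apply']
    refine (SimpleGraph.fromRel_adj _ _ _).2 ⟨fun h => ?_, Or.inl (stdTree_adj_iff.2 rfl)⟩
    have := congrArg StdTree.height h
    simp [StdTree.next] at this

theorem StdTree.iterate_height (p : StdTree I o) (n : ℕ) :
    (StdTree.next^[n] p).height = p.height + n := by
  induction n with
  | zero => simp
  | succ n ih =>
    rw [Function.iterate_succ_apply']
    simp only [StdTree.next, ih]
    push_cast; ring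

theorem StdTree.iterate_path (p : StdTree I o) (n : ℕ) (j : ℤ) (hj : p.height + n ≤ j) :
    (StdTree.next^[n] p).path j = p.path j := by
  induction n with
  | zero => rfl
  | succ n ih =>
    rw [Function.iterate_succ_apply']
    push_cast at hj
    simp only [StdTree.next, StdTree.iterate_height]
    rw [if_neg (by omega)]
    exact ih (by omega)

theorem stdTree_isDirectedTree : (stdTree I o).IsDirectedTree := by
  refine ⟨fun a h => ?_, fun a b h h' => ?_, ?_⟩
  · have := h.1; omega
  · have := h.1; have := h'.1; omega
  constructor
  · refine (SimpleGraph.connected_iff _).2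
      ⟨fun p q => ?_, ⟨⟨0, fun _ => o, fun _ _ => rfl, 0, fun _ _ => rfl⟩⟩⟩
    obtain ⟨N, hN⟩ := p.eventually_eq
    obtain ⟨N', hN'⟩ := q.eventually_eq
    set K := max (max N N') (max p.height q.height) with hK
    have k1 : N ≤ K := le_trans (le_max_left _ _) (le_max_left _ _)
    have k2 : N' ≤ K := le_trans (le_max_right _ _) (le_max_left _ _)
    have k3 : p.height ≤ K := le_trans (le_max_left _ _) (le_max_right _ _)
    have k4 : q.height ≤ K := le_trans (le_max_right _ _) (le_max_right _ _)
    have e : StdTree.next^[(K - p.height).toNat] p = StdTree.next^[(K - q.height).toNat] q := by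
      refine StdTree.ext' ?_ fun j hj => ?_
      · rw [StdTree.iterate_height, StdTree.iterate_height]; omega
      · rw [StdTree.iterate_height] at hj
        rw [StdTree.iterate_path _ _ _ (by omega), StdTree.iterate_path _ _ _ (by omega),
          hN j (by omega), hN' j (by omega)]
    exact (stdTree_reachable_iterate p _).trans (e ▸ (stdTree_reachable_iterate q _).symm)
  · have key : ∀ s t : StdTree I o, (stdTree I o).Adj s t →
        ¬ ((stdTree I o).toSimpleGraphInclusive.deleteEdges {s(s, t)}).Reachable s t := by
      intro s t hst hr
      have inv : ∀ a b : StdTree I o,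
          ((stdTree I o).toSimpleGraphInclusive.deleteEdges {s(s, t)}).Reachable a b →
          (a.height ≤ s.height ∧ ∀ j, s.height ≤ j → a.path j = s.path j) →
          (b.height ≤ s.height ∧ ∀ j, s.height ≤ j → b.path j = s.path j) := by
        rintro a b ⟨W⟩
        induction W with
        | nil => exact id
        | @cons a c b hac _ ih =>
          intro ha
          apply ih
          rw [SimpleGraph.deleteEdges_adj] at hac
          obtain ⟨hac, hne⟩ := hac
          rcases ((SimpleGraph.fromRel_adj _ _ _).1 hac).2 with h | h
          · rcases lt_or_eq_of_le ha.1 with hl | hl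
            · have := h.1
              refine ⟨by omega, fun j hj => ?_⟩
              rw [← h.2 j (by omega)]
              exact ha.2 j hj
            · exfalso
              apply hne
              have hs : a = s := StdTree.ext' hl fun j hj => ha.2 j (hl ▸ hj)
              subst hs
              rw [stdTree_adj_iff] at h hst
              rw [h, hst]
              rfl
          · have := h.1
            refine ⟨by omega, fun j hj => ?_⟩
            rw [h.2 j (by omega)]
            exact ha.2 j hj
      have := (inv s t hr ⟨le_rfl, fun _ _ => rfl⟩).1
      have := hst.1
      omega
    rw [SimpleGraph.isAcyclic_iff_forall_adj_isBridge]
    intro a b hab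
    rw [SimpleGraph.isBridge_iff]
    rcases ((SimpleGraph.fromRel_adj _ _ _).1 hab).2 with h | h
    · exact key a b h
    · intro hr
      exact key b a h (by rw [Sym2.eq_swap]; exact hr.symm)

end StdTree

theorem Subsets.nonempty {m : ℕ} {M : ℕ∞} (h : (m : ℕ∞) ≤ M) : Nonempty (Subsets m M) := by
  let f : Fin m ↪ Omega M :=
    ⟨fun i => ⟨i, lt_of_lt_of_le (by exact_mod_cast i.2) h⟩, fun i j hij => by
      simpa [Fin.ext_iff] using hij⟩
  exact ⟨⟨Finset.univ.map f, by simp⟩⟩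

/-- The construction of `D(m, M)` can be carried out. -/
theorem LabelledTree.nonempty {m : ℕ} {M : ℕ∞} (h : (m : ℕ∞) ≤ M) :
    Nonempty (LabelledTree.{w} m M) := by
  obtain ⟨o⟩ := Subsets.nonempty h
  exact ⟨{
    Vertex := StdTree (ULift.{w} (Subsets m M)) ⟨o⟩
    tree := stdTree _ _
    isTree := stdTree_isDirectedTree
    out_valency := fun t => by rw [stdTree_outSet]; simp
    label := fun t => (stdLabel t).trans Equiv.ulift }⟩

end Digraph

namespace Digraph

/-! ### Reachability classes, descendants and the automorphism that swaps δ-equivalent vertices -/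

section Reachability

variable {V : Type u}

/-! Without directed cycles, two edges lie in the same alternet exactly when their heads are
equivalent under `SameSink`. Both parts rest on showing that `SameSink` and δ coincide. Then the
out-neighbours of a vertex lie in one δ-class, so D/δ is connected and acyclic with a unique
out-neighbour at each vertex, which makes it a tree.

For δ ⊆ `SameSink` the engine is `exists_aut_of_delta`. Two δ-equivalent vertices y, y' have the
same proper descendants, so interchanging them is an isomorphism of descendant sets. Weak
descendant-homogeneity turns it into an automorphism that moves y to y' and fixes a vertex z
reaching neither. If the `SameSink` classes are antichains for reachability, `sameSink_of_delta`
follows. The antichain property comes from transitivity on finite sets: the whole classes for 𝒞, the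
out-neighbourhoods for Σ(m, M).

Conversely, for 𝒞 the δ-classes and the `SameSink` classes have the same finite size. For Σ(m, M)
the sources (S, c) with S fixed form a copy of Ω inside one δ-class, hence among the sinks of one
alternet. Some vertex has all its out-neighbours in this copy, and vertex transitivity carries this
to every vertex.

For (2), coordinates in the δ-classes present D as the digraph of a labelled tree. Permuting Ω in
each fibre makes the labels along one ray constant, and a tree so labelled is isomorphic to the
standard one. Hence D(m, M) does not depend on the choices. -/

theorem NoDirectedCycles.asymm {D : Digraph V} (hc : D.NoDirectedCycles) {a b : V}
    (h : D.Adj a b) : ¬ D.Adj b a :=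
  fun h' => hc a ((Relation.TransGen.single h).tail h')

theorem NoDirectedCycles.ne {D : Digraph V} (hc : D.NoDirectedCycles) {a b : V}
    (h : D.Adj a b) : a ≠ b := by
  rintro rfl
  exact hc.asymm h h

/-- The equivalence relation generated by having a common in-neighbour. -/
def SameSink (D : Digraph V) : V → V → Prop :=
  Relation.ReflTransGen fun y y' => ∃ x, D.Adj x y ∧ D.Adj x y'

theorem SameSink.refl {D : Digraph V} (y : V) : D.SameSink y y := Relation.ReflTransGen.refl

theorem SameSink.symm {D : Digraph V} {y z : V} (h : D.SameSink y z) : D.SameSink z y :=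
  haveI : Std.Symm fun y y' => ∃ x, D.Adj x y ∧ D.Adj x y' :=
    ⟨fun _ _ ⟨x, h1, h2⟩ => ⟨x, h2, h1⟩⟩
  Relation.ReflTransGen.stdSymm.symm _ _ h

theorem SameSink.trans {D : Digraph V} {x y z : V} (h : D.SameSink x y) (h' : D.SameSink y z) :
    D.SameSink x z :=
  Relation.ReflTransGen.trans h h'

theorem SameSink.of_adj {D : Digraph V} {x y z : V} (h : D.Adj x y) (h' : D.Adj x z) :
    D.SameSink y z :=
  Relation.ReflTransGen.single ⟨x, h, h'⟩

theorem SameSink.map {D : Digraph V} (g : D.Aut) {y z : V} (h : D.SameSink y z) :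
    D.SameSink (g y) (g z) :=
  Relation.ReflTransGen.lift g
    (fun _ _ ⟨x, h1, h2⟩ => ⟨g x, g.map_rel_iff.2 h1, g.map_rel_iff.2 h2⟩) _ _ h

theorem sameSink_map_iff {D : Digraph V} (g : D.Aut) {y z : V} :
    D.SameSink (g y) (g z) ↔ D.SameSink y z :=
  ⟨fun h => by simpa using h.map g.symm, SameSink.map g⟩

theorem delta_map_iff {D : Digraph V} (g : D.Aut) {y z : V} :
    D.delta (g y) (g z) ↔ D.delta y z := by
  change D.outSet (g y) = D.outSet (g z) ↔ D.outSet y = D.outSet z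
  simp only [Set.ext_iff, outSet, Set.mem_ofPred_eq]
  constructor
  · intro h a
    simpa [g.map_rel_iff] using h (g a)
  · intro h a
    obtain ⟨b, rfl⟩ := g.surjective a
    simpa [g.map_rel_iff] using h b

theorem delta_iff {D : Digraph V} {y z : V} : D.delta y z ↔ ∀ a, D.Adj y a ↔ D.Adj z a :=
  Set.ext_iff

theorem transGen_map {D : Digraph V} (g : D.Aut) {y z : V} (h : Relation.TransGen D.Adj y z) :
    Relation.TransGen D.Adj (g y) (g z) :=
  Relation.TransGen.lift g (fun _ _ h => g.map_rel_iff.2 h) _ _ h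

/-- Two edges are in the same reachability class iff their heads are linked by common
in-neighbours. -/
theorem edgeReachable_iff {D : Digraph V} (hc : D.NoDirectedCycles) {e e' : V × V} :
    D.EdgeReachable e e' ↔ D.Adj e.1 e.2 ∧ D.Adj e'.1 e'.2 ∧ D.SameSink e.2 e'.2 := by
  constructor
  · rintro ⟨h, h', n, x, hw, rfl, he'⟩
    refine ⟨h, h', ?_⟩
    rcases hw with hw | hw
    -- A walk whose first edge is traversed backwards would contain both `e` and its reverse.
    swap
    · exact absurd ((hw 0 (by omega)).2 (by simp)) (hc.asymm h)
    have key : ∀ j, 2 * j ≤ n → D.SameSink (x 1) (x (2 * j + 1)) := by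
      intro j
      induction j with
      | zero => exact fun _ => SameSink.refl _
      | succ j ih =>
        intro hj
        have h1 := (hw (2 * j + 1) (by omega)).2 ⟨j, rfl⟩
        have h2 := (hw (2 * j + 2) (by omega)).1 ⟨j + 1, by ring⟩
        exact (ih (by omega)).trans (SameSink.of_adj h1 h2)
    rcases Nat.even_or_odd' n with ⟨j, rfl | rfl⟩
    · have h1 := (hw (2 * j) (by omega)).1 ⟨j, by ring⟩
      rcases he' with rfl | rfl
      · exact key j le_rfl
      · exact absurd h1 (hc.asymm h')
    · have h1 := (hw (2 * j + 1) (by omega)).2 ⟨j, by ring⟩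
      rcases he' with rfl | rfl
      · exact absurd h1 (hc.asymm h')
      · exact key j (by omega)
  · rintro ⟨h, h', hs⟩
    have key : ∃ (j : ℕ) (x : ℕ → V), x 0 = e.1 ∧ x 1 = e.2 ∧ x (2 * j + 1) = e'.2 ∧
        ∀ i, i < 2 * j + 1 → (Even i → D.Adj (x i) (x (i + 1))) ∧
          (Odd i → D.Adj (x (i + 1)) (x i)) := by
      generalize e'.2 = y at hs
      induction hs with
      | refl =>
        refine ⟨0, fun i => if i = 0 then e.1 else e.2, by simp, by simp, by simp, ?_⟩
        intro i hi
        obtain rfl : i = 0 := by omega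
        simpa using h
      | @tail b c _ hbc ih =>
        obtain ⟨z, hzb, hzc⟩ := hbc
        obtain ⟨j, x, h0, h1, h2, hw⟩ := ih
        refine ⟨j + 1, fun i => if i ≤ 2 * j + 1 then x i else if i = 2 * j + 2 then z else c,
          by simpa using h0, by simpa using h1, ?_, fun i hi => ?_⟩
        · dsimp only
          rw [if_neg (by omega), if_neg (by omega)]
        rcases lt_or_ge i (2 * j + 1) with h | h
        · simpa [h.le, Nat.succ_le_of_lt h] using hw i h
        · obtain rfl | rfl : i = 2 * j + 1 ∨ i = 2 * j + 2 := by omega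
          · refine ⟨fun hE => ?_, fun _ => ?_⟩
            · exact absurd hE (by simp)
            · simpa [h2] using hzb
          · refine ⟨fun _ => ?_, fun hO => ?_⟩
            · simpa using hzc
            · exact absurd hO (by rw [Nat.not_odd_iff_even]; exact ⟨j + 1, by ring⟩)
    obtain ⟨j, x, h0, h1, h2, hw⟩ := key
    -- The tail of `e'` is appended after its head, so that `e'` is the last edge, traversed
    -- backwards.
    refine ⟨h, h', 2 * j + 1, fun i => if i ≤ 2 * j + 1 then x i else e'.1, Or.inl ?_, ?_, ?_⟩
    · intro i hi
      rcases lt_or_ge i (2 * j + 1) with h | h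
      · simpa [h.le, Nat.succ_le_of_lt h] using hw i h
      · obtain rfl : i = 2 * j + 1 := by omega
        refine ⟨fun hE => ?_, fun _ => ?_⟩
        · exact absurd hE (by simp)
        · simpa [h2] using h'
    · simp [h0, h1]
    · right
      simp [h2]

/-- The non-backtracking condition on arcs is automatic here: its failure is a directed 2-cycle. -/
theorem mem_desc_iff {D : Digraph V} (hc : D.NoDirectedCycles) {x y : V} :
    y ∈ D.desc x ↔ Relation.ReflTransGen D.Adj x y := by
  constructor
  · rintro ⟨s, p, rfl, rfl, hp, -⟩
    induction s with
    | zero => exact .refl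
    | succ s ih => exact (ih fun i hi => hp i (by omega)).tail (hp s (by omega))
  · intro h
    suffices ∃ (s : ℕ) (p : ℕ → V), p 0 = x ∧ p s = y ∧ ∀ i, i < s → D.Adj (p i) (p (i + 1)) by
      obtain ⟨s, p, h0, hs, hp⟩ := this
      refine ⟨s, p, h0, hs, hp, fun i hi he => ?_⟩
      have h1 := hp i (by omega)
      have h2 := hp (i + 1) (by omega)
      exact hc.asymm h1 (he ▸ h2)
    induction h with
    | refl => exact ⟨0, fun _ => x, rfl, rfl, fun _ h => by omega⟩
    | @tail b c _ hbc ih =>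
      obtain ⟨s, p, h0, hs, hp⟩ := ih
      refine ⟨s + 1, fun i => if i ≤ s then p i else c, by simpa using h0, by simp, ?_⟩
      intro i hi
      rcases lt_or_ge i s with h | h
      · simpa [h.le, Nat.succ_le_of_lt h] using hp i h
      · obtain rfl : i = s := by omega
        simpa [hs] using hbc

theorem mem_descSet_iff {D : Digraph V} (hc : D.NoDirectedCycles) {X : Set V} {y : V} :
    y ∈ D.descSet X ↔ ∃ x ∈ X, Relation.ReflTransGen D.Adj x y := by
  simp [descSet, mem_desc_iff hc]

theorem IsDistanceTransitive.isEdgeTransitive {D : Digraph V} (hc : D.NoDirectedCycles)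
    (h : D.IsDistanceTransitive) : D.IsEdgeTransitive := by
  have key : ∀ a b, D.Adj a b → D.AtDistance 1 a b := by
    intro a b hab
    refine ⟨⟨fun i => if i = 0 then a else b, by simp, by simp, fun i hi => ?_,
      fun i hi => by omega⟩, fun t ht => ?_⟩
    · obtain rfl : i = 0 := by omega
      simpa using hab
    · obtain rfl : t = 0 := by omega
      rintro ⟨p, rfl, rfl, -⟩
      exact hc.ne hab rfl
  exact fun a b c d h1 h2 => h 1 a b c d (key a b h1) (key c d h2)

theorem exists_in_neighbour {D : Digraph V} (hvt : D.IsVertexTransitive)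
    (hout : ∀ x, ∃ y, D.Adj x y) (y : V) : ∃ x, D.Adj x y := by
  obtain ⟨z, hz⟩ := hout y
  obtain ⟨g, hg⟩ := hvt z y
  have h := g.map_rel_iff.2 hz
  rw [hg] at h
  exact ⟨g y, h⟩

/-- A finite set on which automorphisms act transitively is an antichain for reachability. -/
theorem not_transGen_of_finite {D : Digraph V} (hc : D.NoDirectedCycles) {S : Set V}
    (hS : S.Finite)
    (hg : ∀ a ∈ S, ∀ b ∈ S, ∃ g : D.Aut, g a = b ∧ ∀ c ∈ S, g c ∈ S) {a b : V}
    (ha : a ∈ S) (hb : b ∈ S) : ¬ Relation.TransGen D.Adj a b := by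
  intro hab
  -- For the reversed order a minimal `t` in `S` reaches nothing in `S`, yet moving `a` to `t` moves
  -- `b` to a vertex of `S` reached from `t`.
  let r : V → V → Prop := fun x y => Relation.TransGen D.Adj y x
  have : IsStrictOrder V r :=
    { irrefl := hc, trans := fun _ _ _ h h' => Relation.TransGen.trans h' h }
  obtain ⟨t, ht, hmin⟩ := (hS.wellFoundedOn (r := r)).has_min (Set.univ : Set S) ⟨⟨a, ha⟩, trivial⟩
  obtain ⟨g, hga, hgS⟩ := hg a ha t t.2
  exact hmin ⟨g b, hgS b hb⟩ trivial (show Relation.TransGen D.Adj t (g b) from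
    hga ▸ transGen_map g hab)

theorem delta.transGen {D : Digraph V} {x y z : V} (h : D.delta x y)
    (h' : Relation.TransGen D.Adj x z) : Relation.TransGen D.Adj y z := by
  obtain ⟨w, hw, hwz⟩ := Relation.TransGen.head'_iff.1 h'
  exact Relation.TransGen.head' ((delta_iff.1 h w).1 hw) hwz

/-- The swap of `y` and `y'` carries one descendant set to the other. The conditions on `z` ensure
that no edge inside these sets enters `y` or `y'`, so only their out-edges matter, and those agree.
-/
theorem IsWeaklyDescendantHomogeneous.exists_aut_of_delta {D : Digraph V}
    (hc : D.NoDirectedCycles) (hwdh : D.IsWeaklyDescendantHomogeneous) {y y' z : V}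
    (h : D.delta y y') (hzy : y ≠ z) (hzy' : y' ≠ z)
    (h1 : ¬ Relation.TransGen D.Adj z y) (h2 : ¬ Relation.TransGen D.Adj z y') :
    ∃ g : D.Aut, g y = y' ∧ g z = z := by
  classical
  rcases eq_or_ne y y' with rfl | hne
  · exact ⟨RelIso.refl _, rfl, rfl⟩
  have key : ∀ a b : V, D.delta a b → a ≠ z → b ≠ z → a ≠ b → ¬ Relation.TransGen D.Adj z a →
      ¬ Relation.TransGen D.Adj z b → (∀ w, D.Adj w a → w ∉ D.descSet {a, z}) ∧
        b ∉ D.descSet {a, z} ∧ ∀ w, w ∈ D.descSet {a, z} → w ≠ a → w ∈ D.descSet {b, z} := by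
    intro a b hab haz hbz hne ha hb
    simp only [mem_descSet_iff hc, Set.mem_insert_iff, Set.mem_singleton_iff, exists_eq_or_imp,
      exists_eq_left, not_or]
    refine ⟨fun w hw => ⟨fun h' => hc a (Relation.TransGen.tail' h' hw),
      fun h' => ha (Relation.TransGen.tail' h' hw)⟩, ⟨fun h' => ?_, fun h' => ?_⟩, ?_⟩
    · rcases Relation.reflTransGen_iff_eq_or_transGen.1 h' with h' | h'
      · exact hne h'.symm
      · exact hc b (delta.transGen hab h')
    · rcases Relation.reflTransGen_iff_eq_or_transGen.1 h' with h' | h'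
      · exact hbz h'
      · exact hb h'
    · rintro w (h' | h') hwa
      · rcases Relation.reflTransGen_iff_eq_or_transGen.1 h' with h' | h'
        · exact absurd h' hwa
        · exact Or.inl (delta.transGen hab h').to_reflTransGen
      · exact Or.inr h'
  obtain ⟨k1, k2, k3⟩ := key y y' h hzy hzy' hne h1 h2
  obtain ⟨l1, l2, l3⟩ := key y' y h.symm hzy' hzy hne.symm h2 h1
  have hyX : y ∈ D.descSet {y, z} := (mem_descSet_iff hc).2 ⟨y, by simp, .refl⟩
  have hzX : z ∈ D.descSet {y, z} := (mem_descSet_iff hc).2 ⟨z, by simp, .refl⟩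
  have hyX' : y' ∈ D.descSet {y', z} := (mem_descSet_iff hc).2 ⟨y', by simp, .refl⟩
  have hmem : ∀ w, w ∈ D.descSet {y, z} ↔ Equiv.swap y y' w ∈ D.descSet {y', z} := by
    intro w
    rcases eq_or_ne w y with rfl | hwy
    · simp [hyX, hyX']
    rcases eq_or_ne w y' with rfl | hwy'
    · simp [k2, l2]
    rw [Equiv.swap_apply_of_ne_of_ne hwy hwy']
    exact ⟨fun h => k3 w h hwy, fun h => l3 w h hwy'⟩
  let f : (D.inducedOn (D.descSet {y, z})).Iso (D.inducedOn (D.descSet {y', z})) :=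
    { toEquiv := (Equiv.swap y y').subtypeEquiv hmem
      map_rel_iff' := by
        rintro ⟨a, ha⟩ ⟨b, hb⟩
        change D.Adj (Equiv.swap y y' a) (Equiv.swap y y' b) ↔ D.Adj a b
        have hay' : a ≠ y' := fun h => k2 (h ▸ ha)
        have hby' : b ≠ y' := fun h => k2 (h ▸ hb)
        rcases eq_or_ne b y with rfl | hby
        · rw [Equiv.swap_apply_left]
          exact ⟨fun h => absurd ((hmem a).1 ha) (l1 _ h), fun h => absurd ha (k1 _ h)⟩
        rw [Equiv.swap_apply_of_ne_of_ne hby hby']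
        rcases eq_or_ne a y with rfl | hay
        · rw [Equiv.swap_apply_left]
          exact (delta_iff.1 h b).symm
        · rw [Equiv.swap_apply_of_ne_of_ne hay hay'] }
  obtain ⟨g, hg⟩ := hwdh.2 {y, z} {y', z} (by simp) (by simp) f
  refine ⟨g, ?_, ?_⟩
  · rw [hg y hyX (by simp)]
    exact Equiv.swap_apply_left y y'
  · rw [hg z hzX (by simp)]
    exact Equiv.swap_apply_of_ne_of_ne hzy.symm hzy'.symm

/-- If reachability classes of heads are antichains, vertices with the same out-neighbours
are heads in the same alternet. -/
theorem IsWeaklyDescendantHomogeneous.sameSink_of_delta {D : Digraph V}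
    (hc : D.NoDirectedCycles) (hwdh : D.IsWeaklyDescendantHomogeneous)
    (hin : ∀ y, ∃ x, D.Adj x y)
    (hout : ∀ x y, ∃ z, D.Adj x z ∧ z ≠ y)
    (hanti : ∀ y z, D.SameSink y z → ¬ Relation.TransGen D.Adj y z) {y y' : V}
    (h : D.delta y y') : D.SameSink y y' := by
  by_contra hn
  -- Otherwise an automorphism moves `a` to `a'` and fixes `b`, which puts `a'` into the class of
  -- `b`, that is, of `a`.
  have key : ∀ a a' b, D.delta a a' → ¬ D.SameSink a a' → D.SameSink a b → a ≠ b →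
      Relation.TransGen D.Adj b a' := by
    intro a a' b h1 h2 h3 h4
    by_contra h5
    obtain ⟨g, rfl, hg⟩ := hwdh.exists_aut_of_delta hc h1 h4 (by rintro rfl; exact h2 h3)
      (hanti b a h3.symm) h5
    have := h3.map g
    rw [hg] at this
    exact h2 (h3.trans this.symm)
  obtain ⟨x, hx⟩ := hin y
  obtain ⟨z, hxz, hzy⟩ := hout x y
  have hyz : D.SameSink y z := SameSink.of_adj hx hxz
  -- `z` reaches `y'` through `w`. Another out-neighbour `v` of `w` is in the class of `y'`, so it
  -- reaches `y`; thus `z` reaches `y` inside an antichain.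
  obtain ⟨w, hzw, hwy'⟩ := Relation.TransGen.tail'_iff.1 (key y y' z h hn hyz hzy.symm)
  obtain ⟨v, hwv, hvy'⟩ := hout w y'
  have hvy := key y' y v h.symm (fun h => hn h.symm) (SameSink.of_adj hwy' hwv) hvy'.symm
  exact hanti z y hyz.symm ((Relation.TransGen.tail' hzw hwv).trans hvy)

end Reachability

/-! ### The quotient by δ, counting δ-classes, and alternets in 𝒞 -/

section Quotient

variable {V : Type u}

/-- The representative of the tail is immaterial, since δ-equivalent vertices have the same
out-neighbours; that of the head is not. Hence directed paths in the quotient lift from any given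
starting vertex. -/
theorem quotientBy_delta_adj {D : Digraph V} {x y : V} :
    (D.quotientBy D.delta).Adj (Quotient.mk _ x) (Quotient.mk _ y) ↔
      ∃ z, D.Adj x z ∧ D.delta z y := by
  constructor
  · rintro ⟨a, b, ha, hb, hab⟩
    exact ⟨b, (delta_iff.1 (Quotient.exact ha) b).1 hab, Quotient.exact hb⟩
  · rintro ⟨z, hxz, hzy⟩
    exact ⟨x, z, rfl, Quotient.sound hzy, hxz⟩

theorem transGen_of_quotientBy_delta {D : Digraph V} {x : V} {B : Quotient D.delta}
    (h : Relation.TransGen (D.quotientBy D.delta).Adj (Quotient.mk _ x) B) :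
    ∃ y, Quotient.mk _ y = B ∧ Relation.TransGen D.Adj x y := by
  induction h with
  | @single B h =>
    induction B using Quotient.ind
    obtain ⟨z, h1, h2⟩ := quotientBy_delta_adj.1 h
    exact ⟨z, Quotient.sound h2, .single h1⟩
  | @tail B C _ h ih =>
    obtain ⟨y, rfl, hy⟩ := ih
    induction C using Quotient.ind
    obtain ⟨z, h1, h2⟩ := quotientBy_delta_adj.1 h
    exact ⟨z, Quotient.sound h2, hy.tail h1⟩

theorem NoDirectedCycles.quotientBy_delta {D : Digraph V} (hc : D.NoDirectedCycles) :
    (D.quotientBy D.delta).NoDirectedCycles := by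
  intro A hA
  induction A using Quotient.ind
  obtain ⟨y, hy, h⟩ := transGen_of_quotientBy_delta hA
  exact hc y (delta.transGen (D.delta.symm (Quotient.exact hy)) h)

theorem IsConnected.quotientBy_delta {D : Digraph V} (hc : D.NoDirectedCycles)
    (hconn : D.IsConnected) : (D.quotientBy D.delta).IsConnected := by
  obtain ⟨hp, ⟨x⟩⟩ := (SimpleGraph.connected_iff _).1 hconn
  refine (SimpleGraph.connected_iff _).2 ⟨fun A B => ?_, ⟨Quotient.mk _ x⟩⟩
  induction A using Quotient.ind with | _ a
  induction B using Quotient.ind with | _ b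
  obtain ⟨w⟩ := hp a b
  induction w with
  | nil => exact SimpleGraph.Reachable.refl _
  | @cons a c b hac _ ih =>
    refine SimpleGraph.Reachable.trans (SimpleGraph.Adj.reachable ?_) ih
    have h : (D.quotientBy D.delta).Adj (Quotient.mk _ a) (Quotient.mk _ c) ∨
        (D.quotientBy D.delta).Adj (Quotient.mk _ c) (Quotient.mk _ a) :=
      ((SimpleGraph.fromRel_adj _ _ _).1 hac).2.imp
        (fun h => quotientBy_delta_adj.2 ⟨c, h, D.delta.refl _⟩)
        (fun h => quotientBy_delta_adj.2 ⟨a, h, D.delta.refl _⟩)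
    exact (SimpleGraph.fromRel_adj _ _ _).2
      ⟨h.elim hc.quotientBy_delta.ne fun h => (hc.quotientBy_delta.ne h).symm, h⟩

/-- Every edge s → t is a bridge: by uniqueness of out-neighbours it is the only edge leaving the
set of vertices that reach s, and t is outside this set. -/
theorem isDirectedTree_of_functional {D : Digraph V} (hc : D.NoDirectedCycles)
    (hconn : D.IsConnected) (hf : ∀ a b c, D.Adj a b → D.Adj a c → b = c) :
    D.IsDirectedTree := by
  refine ⟨fun a h => hc.ne h rfl, fun a b h => hc.asymm h, hconn, ?_⟩
  have key : ∀ s t, D.Adj s t →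
      ¬ (D.toSimpleGraphInclusive.deleteEdges {s(s, t)}).Reachable s t := by
    intro s t hst hr
    have inv : ∀ a b, (D.toSimpleGraphInclusive.deleteEdges {s(s, t)}).Reachable a b →
        Relation.ReflTransGen D.Adj a s → Relation.ReflTransGen D.Adj b s := by
      rintro a b ⟨W⟩
      induction W with
      | nil => exact id
      | @cons a c b hac _ ih =>
        intro ha
        apply ih
        rw [SimpleGraph.deleteEdges_adj] at hac
        obtain ⟨hac, hne⟩ := hac
        rcases ((SimpleGraph.fromRel_adj _ _ _).1 hac).2 with h | h
        · rcases Relation.ReflTransGen.cases_head ha with rfl | ⟨d, had, hds⟩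
          · exact absurd (by rw [hf a c t h hst]; rfl) hne
          · rwa [hf a c d h had]
        · exact ha.head h
    exact hc s (Relation.TransGen.head' hst (inv s t hr .refl))
  rw [SimpleGraph.isAcyclic_iff_forall_adj_isBridge]
  intro a b hab
  rw [SimpleGraph.isBridge_iff]
  rcases ((SimpleGraph.fromRel_adj _ _ _).1 hab).2 with h | h
  · exact key a b h
  · intro hr
    exact key b a h (by rw [Sym2.eq_swap]; exact hr.symm)

/-- Both images are injective projections of the set of pairs (f a, f' (h a)). -/
theorem encard_image_eq_of_ker_eq {α β γ γ' : Type*} {f : α → γ} {f' : β → γ'} {s : Set α}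
    {t : Set β} (h : α → β) (hst : h '' s = t)
    (hk : ∀ a ∈ s, ∀ b ∈ s, f a = f b ↔ f' (h a) = f' (h b)) :
    (f '' s).encard = (f' '' t).encard := by
  have h1 : f '' s = Prod.fst '' ((fun a => (f a, f' (h a))) '' s) := by
    rw [Set.image_image]
  have h2 : f' '' t = Prod.snd '' ((fun a => (f a, f' (h a))) '' s) := by
    rw [Set.image_image, ← hst, Set.image_image]
  have i1 : Set.InjOn Prod.fst ((fun a => (f a, f' (h a))) '' s) := by
    rintro _ ⟨a, ha, rfl⟩ _ ⟨b, hb, rfl⟩ hab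
    exact Prod.ext hab ((hk a ha b hb).1 hab)
  have i2 : Set.InjOn Prod.snd ((fun a => (f a, f' (h a))) '' s) := by
    rintro _ ⟨a, ha, rfl⟩ _ ⟨b, hb, rfl⟩ hab
    exact Prod.ext ((hk a ha b hb).2 hab) hab
  rw [h1, h2, i1.encard_image, i2.encard_image]

theorem alternet_adj {D : Digraph V} (hc : D.NoDirectedCycles) {e : V × V} (he : D.Adj e.1 e.2)
    {a b : D.alternetVertices e} :
    (D.alternet e).Adj a b ↔ D.Adj a b ∧ D.SameSink e.2 b :=
  (edgeReachable_iff hc).trans (and_iff_right he)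

theorem mem_alternetVertices_of_source {D : Digraph V} (hc : D.NoDirectedCycles) {e : V × V}
    (he : D.Adj e.1 e.2) {a b : V} (hab : D.Adj a b) (hb : D.SameSink e.2 b) :
    a ∈ D.alternetVertices e :=
  ⟨(a, b), (edgeReachable_iff hc).2 ⟨he, hab, hb⟩, Or.inl rfl⟩

theorem mem_alternetVertices_of_sink {D : Digraph V} (hc : D.NoDirectedCycles) {e : V × V}
    (he : D.Adj e.1 e.2) {a b : V} (hab : D.Adj a b) (hb : D.SameSink e.2 b) :
    b ∈ D.alternetVertices e :=
  ⟨(a, b), (edgeReachable_iff hc).2 ⟨he, hab, hb⟩, Or.inr rfl⟩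

/-- All out-edges of a vertex lie in one reachability class, so a source loses no out-neighbours in
its alternet, and δ on sources can be computed in D. -/
theorem alternet_adj_iff_of_mem_sources {D : Digraph V} (hc : D.NoDirectedCycles) {e : V × V}
    (he : D.Adj e.1 e.2) {a : D.alternetVertices e} (ha : a ∈ (D.alternet e).sources)
    {z : V} : (∃ h : z ∈ D.alternetVertices e, (D.alternet e).Adj a ⟨z, h⟩) ↔ D.Adj a z := by
  obtain ⟨y, hy⟩ := ha
  rw [alternet_adj hc he] at hy
  constructor
  · rintro ⟨h, h'⟩
    exact ((alternet_adj hc he).1 h').1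
  · intro h
    have hs := hy.2.trans (SameSink.of_adj hy.1 h)
    exact ⟨mem_alternetVertices_of_sink hc he h hs, (alternet_adj hc he).2 ⟨h, hs⟩⟩

theorem alternet_delta_iff {D : Digraph V} (hc : D.NoDirectedCycles) {e : V × V}
    (he : D.Adj e.1 e.2) {a b : D.alternetVertices e} (ha : a ∈ (D.alternet e).sources)
    (hb : b ∈ (D.alternet e).sources) : (D.alternet e).delta a b ↔ D.delta a b := by
  rw [delta_iff, delta_iff]
  constructor
  · intro h z
    rw [← alternet_adj_iff_of_mem_sources hc he ha, ← alternet_adj_iff_of_mem_sources hc he hb]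
    exact exists_congr fun _ => h _
  · rintro h ⟨z, hz⟩
    have := h z
    rw [← alternet_adj_iff_of_mem_sources hc he ha,
      ← alternet_adj_iff_of_mem_sources hc he hb] at this
    simpa [hz] using this

/-- The tails of the edges whose head is in the same alternet as `y`. -/
def tailsOver (D : Digraph V) (y : V) : Set V := {x | ∃ z, D.Adj x z ∧ D.SameSink y z}

/-- Counting in D lets automorphisms compare different alternets. -/
theorem numDeltaClasses_alternet {D : Digraph V} (hc : D.NoDirectedCycles) {e : V × V}
    (he : D.Adj e.1 e.2) :
    (D.alternet e).numDeltaClasses = (Quotient.mk D.delta '' D.tailsOver e.2).encard := by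
  refine encard_image_eq_of_ker_eq Subtype.val ?_ fun a ha b hb => ?_
  · ext x
    constructor
    · rintro ⟨a, ⟨b, hb⟩, rfl⟩
      exact ⟨b, (alternet_adj hc he).1 hb⟩
    · rintro ⟨z, h1, h2⟩
      exact ⟨⟨x, mem_alternetVertices_of_source hc he h1 h2⟩,
        ⟨⟨z, mem_alternetVertices_of_sink hc he h1 h2⟩, (alternet_adj hc he).2 ⟨h1, h2⟩⟩, rfl⟩
  · rw [Quotient.eq, Quotient.eq]
    exact alternet_delta_iff hc he ha hb

theorem encard_tailsOver_map {D : Digraph V} (g : D.Aut) (y : V) :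
    (Quotient.mk D.delta '' D.tailsOver y).encard =
      (Quotient.mk D.delta '' D.tailsOver (g y)).encard := by
  refine encard_image_eq_of_ker_eq g ?_ fun a _ b _ => ?_
  · ext x
    constructor
    · rintro ⟨a, ⟨z, h1, h2⟩, rfl⟩
      exact ⟨g z, g.map_rel_iff.2 h1, h2.map g⟩
    · rintro ⟨z, h1, h2⟩
      obtain ⟨x, rfl⟩ := g.surjective x
      obtain ⟨z, rfl⟩ := g.surjective z
      exact ⟨x, ⟨z, g.map_rel_iff.1 h1, (sameSink_map_iff g).1 h2⟩, rfl⟩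
  · rw [Quotient.eq, Quotient.eq]
    exact (delta_map_iff g).symm

theorem inSet_quotientBy_delta {D : Digraph V} (hδ : ∀ y z, D.delta y z ↔ D.SameSink y z) (y : V) :
    (D.quotientBy D.delta).inSet (Quotient.mk _ y) = Quotient.mk _ '' D.tailsOver y := by
  ext B
  induction B using Quotient.ind with | _ x
  constructor
  · intro h
    obtain ⟨z, h1, h2⟩ := quotientBy_delta_adj.1 h
    exact ⟨x, ⟨z, h1, ((hδ _ _).1 h2).symm⟩, rfl⟩
  · rintro ⟨x', ⟨z, h1, h2⟩, hx⟩
    rw [← hx]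
    exact quotientBy_delta_adj.2 ⟨z, h1, (hδ _ _).2 h2.symm⟩

theorem encard_inSet_quotientBy_delta {D : Digraph V} (hc : D.NoDirectedCycles)
    (hvt : D.IsVertexTransitive) (hδ : ∀ y z, D.delta y z ↔ D.SameSink y z) {e : V × V}
    (he : D.Adj e.1 e.2) (A : Quotient D.delta) :
    ((D.quotientBy D.delta).inSet A).encard = (D.alternet e).numDeltaClasses := by
  induction A using Quotient.ind with | _ y
  obtain ⟨g, hg⟩ := hvt y e.2
  rw [numDeltaClasses_alternet hc he, inSet_quotientBy_delta hδ, encard_tailsOver_map g, hg]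

theorem quotientBy_delta_functional {D : Digraph V}
    (hδ : ∀ x y z, D.Adj x y → D.Adj x z → D.delta y z) (A B C : Quotient D.delta)
    (h : (D.quotientBy D.delta).Adj A B) (h' : (D.quotientBy D.delta).Adj A C) : B = C := by
  induction A using Quotient.ind
  induction B using Quotient.ind
  induction C using Quotient.ind
  obtain ⟨y, h1, h2⟩ := quotientBy_delta_adj.1 h
  obtain ⟨z, h3, h4⟩ := quotientBy_delta_adj.1 h'
  exact Quotient.sound (D.delta.trans (D.delta.symm h2) (D.delta.trans (hδ _ _ _ h1 h3) h4))

theorem isDirectedTree_quotientBy_delta {D : Digraph V} (hc : D.NoDirectedCycles)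
    (hconn : D.IsConnected) (hδ : ∀ x y z, D.Adj x y → D.Adj x z → D.delta y z) :
    (D.quotientBy D.delta).IsDirectedTree :=
  isDirectedTree_of_functional hc.quotientBy_delta (hconn.quotientBy_delta hc)
    (quotientBy_delta_functional hδ)

theorem encard_outSet_quotientBy_delta {D : Digraph V} (hout : ∀ x, ∃ y, D.Adj x y)
    (hδ : ∀ x y z, D.Adj x y → D.Adj x z → D.delta y z) (A : Quotient D.delta) :
    ((D.quotientBy D.delta).outSet A).encard = 1 := by
  rw [Set.encard_eq_one]
  induction A using Quotient.ind with | _ x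
  obtain ⟨y, hy⟩ := hout x
  have h := quotientBy_delta_adj.2 ⟨y, hy, D.delta.refl _⟩
  exact ⟨Quotient.mk _ y, Set.eq_singleton_iff_unique_mem.2
    ⟨h, fun B hB => quotientBy_delta_functional hδ _ _ _ hB h⟩⟩

theorem sameSink_class_map {D : Digraph V} (g : D.Aut) (y : V) :
    {z | D.SameSink (g y) z} = g '' {z | D.SameSink y z} := by
  ext z
  obtain ⟨z, rfl⟩ := g.surjective z
  simp [sameSink_map_iff g]

theorem delta_class_map {D : Digraph V} (g : D.Aut) (y : V) :
    {z | D.delta (g y) z} = g '' {z | D.delta y z} := by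
  ext z
  obtain ⟨z, rfl⟩ := g.surjective z
  simp [delta_map_iff g]

/-- As there are no isolated vertices, the two parts must be the tails and the heads of the
alternet. The whole δ-class of the tail of `e` lies in the alternet, because its members also point
to the head of `e`. -/
theorem encard_eq_of_inClassC {D : Digraph V} (hc : D.NoDirectedCycles)
    (hin : ∀ y, ∃ x, D.Adj x y) {e : V × V} (he : D.Adj e.1 e.2) (hC : (D.alternet e).InClassC) :
    {z | D.SameSink e.2 z}.Finite ∧
      {z | D.SameSink e.2 z}.encard = {z | D.delta e.1 z}.encard := by
  obtain ⟨X, Y, hXY, -, hadj, hiso, -, -, hYf, -, -, -, hcard⟩ := hC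
  have hY : Subtype.val '' Y = {z | D.SameSink e.2 z} := by
    ext z
    constructor
    · rintro ⟨b, hb, rfl⟩
      obtain ⟨c, h | h⟩ := hiso b
      · exact absurd hb (Set.disjoint_left.1 hXY (hadj _ _ h).1)
      · exact ((alternet_adj hc he).1 h).2
    · intro hz
      replace hz : D.SameSink e.2 z := hz
      obtain ⟨x, hx⟩ := hin z
      exact ⟨⟨z, mem_alternetVertices_of_sink hc he hx hz⟩,
        (hadj ⟨x, mem_alternetVertices_of_source hc he hx hz⟩ _
          ((alternet_adj hc he).2 ⟨hx, hz⟩)).2, rfl⟩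
  have hX : ∀ {a}, a ∈ X → a ∈ (D.alternet e).sources := by
    intro a ha
    obtain ⟨c, h | h⟩ := hiso a
    · exact ⟨c, h⟩
    · exact absurd (hadj _ _ h).2 (Set.disjoint_left.1 hXY ha)
  have hX' : ∀ {a}, a ∈ (D.alternet e).sources → a ∈ X := fun ⟨_, h⟩ => (hadj _ _ h).1
  have mem : ∀ {a}, D.delta e.1 a → ∃ h : a ∈ D.alternetVertices e,
      (⟨a, h⟩ : D.alternetVertices e) ∈ (D.alternet e).sources := by
    intro a ha
    have h := (delta_iff.1 ha e.2).1 he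
    exact ⟨mem_alternetVertices_of_source hc he h (.refl _),
      ⟨⟨e.2, mem_alternetVertices_of_sink hc he h (.refl _)⟩,
        (alternet_adj hc he).2 ⟨h, .refl _⟩⟩⟩
  obtain ⟨h1, h2⟩ := mem (D.delta.refl e.1)
  have hδ : Subtype.val '' {b ∈ X | (D.alternet e).delta ⟨e.1, h1⟩ b} =
      {z | D.delta e.1 z} := by
    ext z
    constructor
    · rintro ⟨b, ⟨hb, hb'⟩, rfl⟩
      exact (alternet_delta_iff hc he h2 (hX hb)).1 hb'
    · intro hz
      obtain ⟨h3, h4⟩ := mem hz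
      exact ⟨⟨z, h3⟩, ⟨hX' h4, (alternet_delta_iff hc he h2 h4).2 hz⟩, rfl⟩
  rw [← hY, ← hδ, Subtype.val_injective.encard_image, Subtype.val_injective.encard_image]
  exact ⟨hYf.image _, hcard _ (hX' h2)⟩

theorem exists_delta_of_inClassC {D : Digraph V} (hc : D.NoDirectedCycles) {e : V × V}
    (he : D.Adj e.1 e.2) (hC : (D.alternet e).InClassC) : ∃ x y : V, x ≠ y ∧ D.delta x y := by
  obtain ⟨X, Y, hXY, -, hadj, hiso, -, -, -, -, -, ⟨a, ha, b, hb, hab, h⟩, -⟩ := hC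
  have hX : ∀ {a}, a ∈ X → a ∈ (D.alternet e).sources := by
    intro a ha
    obtain ⟨c, h | h⟩ := hiso a
    · exact ⟨c, h⟩
    · exact absurd (hadj _ _ h).2 (Set.disjoint_left.1 hXY ha)
  exact ⟨a, b, fun h => hab (Subtype.ext h), (alternet_delta_iff hc he (hX ha) (hX hb)).1 h⟩

theorem IsWeaklyDescendantHomogeneous.delta_iff_sameSink_of_inClassC {D : Digraph V}
    (hc : D.NoDirectedCycles) (hwdh : D.IsWeaklyDescendantHomogeneous)
    (hout : ∀ x y, ∃ z, D.Adj x z ∧ z ≠ y) {e : V × V} (he : D.Adj e.1 e.2)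
    (hC : (D.alternet e).InClassC) (y z : V) : D.delta y z ↔ D.SameSink y z := by
  have hin := exists_in_neighbour hwdh.1 fun x => (hout x x).imp fun _ h => h.1
  obtain ⟨hf, hcard⟩ := encard_eq_of_inClassC hc hin he hC
  have hfin : ∀ y, {z | D.SameSink y z}.Finite := by
    intro y
    obtain ⟨g, rfl⟩ := hwdh.1 e.2 y
    rw [sameSink_class_map]
    exact hf.image g
  have hanti : ∀ y z, D.SameSink y z → ¬ Relation.TransGen D.Adj y z := by
    intro y z hyz
    refine not_transGen_of_finite hc (hfin y) (fun a ha b hb => ?_) (.refl _) hyz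
    obtain ⟨g, rfl⟩ := hwdh.1 a b
    exact ⟨g, rfl, fun c hc => SameSink.trans hb ((SameSink.trans (SameSink.symm ha) hc).map g)⟩
  refine ⟨hwdh.sameSink_of_delta hc hin hout hanti, fun h => ?_⟩
  have hsub : {z | D.delta y z} ⊆ {z | D.SameSink y z} :=
    fun z hz => hwdh.sameSink_of_delta hc hin hout hanti hz
  have heq : {z | D.delta y z} = {z | D.SameSink y z} := by
    refine ((hfin y).subset hsub).eq_of_subset_of_encard_le hsub (le_of_eq ?_)
    -- The sizes are compared at the two ends of `e`; vertex transitivity moves each end to `y`.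
    obtain ⟨g, hg⟩ := hwdh.1 e.2 y
    obtain ⟨g', hg'⟩ := hwdh.1 e.1 y
    calc {z | D.SameSink y z}.encard = {z | D.SameSink e.2 z}.encard := by
          rw [← hg, sameSink_class_map, g.injective.encard_image]
      _ = {z | D.delta e.1 z}.encard := hcard
      _ = {z | D.delta y z}.encard := by
          rw [← hg', delta_class_map, g'.injective.encard_image]
  exact heq.symm.subset h

end Quotient

/-! ### Alternets isomorphic to Σ(m, M) -/

section Sigma

variable {V : Type u} {m : ℕ} {M : ℕ∞}

theorem exists_subsets_superset (h : (m : ℕ∞) ≤ M) (F : Finset (Omega M)) (hF : F.card ≤ m) :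
    ∃ S : Subsets m M, F ⊆ S.1 := by
  classical
  obtain ⟨S₀⟩ := Subsets.nonempty h
  obtain ⟨S, h1, -, h2⟩ := Finset.exists_subsuperset_card_eq
    (Finset.subset_union_left (s₁ := F) (s₂ := S₀.1)) hF
    (S₀.2.symm.le.trans (Finset.card_le_card Finset.subset_union_right))
  exact ⟨⟨S, h2⟩, h1⟩

/-- Coordinates in an alternet that is isomorphic to `Σ(m, M)`. -/
theorem exists_coordinates_of_alternet_iso {D : Digraph V} (hc : D.NoDirectedCycles)
    (hin : ∀ y, ∃ x, D.Adj x y) (hm : 0 < m) (hM : (m : ℕ∞) ≤ M) {e : V × V}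
    (he : D.Adj e.1 e.2) (φ : (D.alternet e).Iso (SigmaDigraph m M)) :
    ∃ (β : {z // D.SameSink e.2 z} ≃ Omega M) (γ : Subsets m M × Omega M → V),
      Function.Injective γ ∧
      ∀ p y, D.Adj (γ p) y ↔ ∃ h : D.SameSink e.2 y, β ⟨y, h⟩ ∈ p.1.1 := by
  have hadj : ∀ (p : Subsets m M × Omega M) (a : Omega M), a ∈ p.1.1 →
      (D.alternet e).Adj (φ.symm (Sum.inl p)) (φ.symm (Sum.inr a)) :=
    fun p a ha => φ.symm.map_rel_iff.2 ⟨p.1, p.2, a, rfl, rfl, ha⟩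
  have hsink : ∀ a : Omega M, D.SameSink e.2 (φ.symm (Sum.inr a)) := by
    intro a
    obtain ⟨S, hS⟩ := exists_subsets_superset hM {a} (by rw [Finset.card_singleton]; exact hm)
    exact ((alternet_adj hc he).1 (hadj (S, a) a (hS (by simp)))).2
  have hsink' : ∀ (z : V) (hz : D.SameSink e.2 z), ∃ h : z ∈ D.alternetVertices e,
      ∃ a, φ ⟨z, h⟩ = Sum.inr a := by
    intro z hz
    obtain ⟨x, hx⟩ := hin z
    have h1 := mem_alternetVertices_of_source hc he hx hz
    have h2 := mem_alternetVertices_of_sink hc he hx hz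
    have : (D.alternet e).Adj ⟨x, h1⟩ ⟨z, h2⟩ := (alternet_adj hc he).2 ⟨hx, hz⟩
    obtain ⟨S, c, a, -, ha, -⟩ := φ.map_rel_iff.2 this
    exact ⟨h2, a, ha⟩
  let f : Omega M → {z // D.SameSink e.2 z} := fun a => ⟨φ.symm (Sum.inr a), hsink a⟩
  have hf : Function.Bijective f := by
    constructor
    · intro a b hab
      have h := congrArg Subtype.val hab
      exact Sum.inr.inj (φ.symm.injective (Subtype.ext h))
    · rintro ⟨z, hz⟩
      obtain ⟨h, a, ha⟩ := hsink' z hz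
      refine ⟨a, Subtype.ext ?_⟩
      change ((φ.symm (Sum.inr a) : D.alternetVertices e) : V) = z
      rw [← ha, RelIso.symm_apply_apply]
  refine ⟨(Equiv.ofBijective f hf).symm, fun p => φ.symm (Sum.inl p), ?_, fun p y => ?_⟩
  · intro p q hpq
    exact Sum.inl.inj (φ.symm.injective (Subtype.ext hpq))
  · constructor
    · intro h
      obtain ⟨a, ha⟩ : p.1.1.Nonempty := Finset.card_pos.1 (by rw [p.1.2]; exact hm)
      have h1 := (alternet_adj hc he).1 (hadj p a ha)
      have hy : D.SameSink e.2 y := h1.2.trans (SameSink.of_adj h1.1 h)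
      refine ⟨hy, ?_⟩
      obtain ⟨hmem, b, hb⟩ := hsink' y hy
      have h2 : (D.alternet e).Adj (φ.symm (Sum.inl p)) ⟨y, hmem⟩ :=
        (alternet_adj hc he).2 ⟨h, hy⟩
      have h3 := φ.map_rel_iff.2 h2
      rw [RelIso.apply_symm_apply, hb] at h3
      obtain ⟨S, c, d, h4, h5, h6⟩ := h3
      obtain rfl := Sum.inl.inj h4
      obtain rfl := Sum.inr.inj h5
      have h7 : f b = ⟨y, hy⟩ := by
        refine Subtype.ext ?_
        change ((φ.symm (Sum.inr b) : D.alternetVertices e) : V) = y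
        rw [← hb, RelIso.symm_apply_apply]
      rw [← h7, Equiv.ofBijective_symm_apply_apply]
      exact h6
    · rintro ⟨h, h'⟩
      have h1 := ((alternet_adj hc he).1 (hadj p _ h')).1
      have h2 := Equiv.ofBijective_apply_symm_apply f hf ⟨y, h⟩
      have h3 : ((φ.symm (Sum.inr ((Equiv.ofBijective f hf).symm ⟨y, h⟩)) :
        D.alternetVertices e) : V) = y := congrArg Subtype.val h2
      rwa [h3] at h1

/-- No counting is available when Ω is infinite; instead a full copy of Ω inside one δ-class
provides one vertex with pairwise δ-equivalent out-neighbours. -/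
theorem IsWeaklyDescendantHomogeneous.delta_of_alternet_iso {D : Digraph V}
    (hc : D.NoDirectedCycles) (hwdh : D.IsWeaklyDescendantHomogeneous)
    (het : D.IsEdgeTransitive) (hm : 1 < m) (hM : (m : ℕ∞) ≤ M)
    (hfin : ∀ x, (D.outSet x).Finite)
    (hout : ∀ x y, ∃ z, D.Adj x z ∧ z ≠ y)
    (hS : ∀ e : V × V, D.Adj e.1 e.2 → Nonempty ((D.alternet e).Iso (SigmaDigraph m M))) :
    (∀ y z, D.delta y z → D.SameSink y z) ∧ ∀ x y z, D.Adj x y → D.Adj x z → D.delta y z := by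
  classical
  have hin := exists_in_neighbour hwdh.1 fun x => (hout x x).imp fun _ h => h.1
  -- This uses m > 1: the labels of two sinks fit into one m-element subset.
  have hcommon : ∀ y z, D.SameSink y z → ∃ x, D.Adj x y ∧ D.Adj x z := by
    intro y z hyz
    obtain ⟨w, hw⟩ := hin y
    obtain ⟨φ⟩ := hS (w, y) hw
    obtain ⟨β, γ, -, hγ⟩ := exists_coordinates_of_alternet_iso hc hin (by omega) hM hw φ
    obtain ⟨S, hS⟩ := exists_subsets_superset hM {β ⟨y, .refl y⟩, β ⟨z, hyz⟩}
      (Finset.card_le_two.trans hm)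
    exact ⟨γ (S, β ⟨y, .refl y⟩), (hγ _ _).2 ⟨.refl y, hS (by simp)⟩,
      (hγ _ _).2 ⟨hyz, hS (by simp)⟩⟩
  -- The class may be infinite, so the finite set used is the out-neighbourhood of a common
  -- in-neighbour, where edge transitivity acts.
  have hanti : ∀ y z, D.SameSink y z → ¬ Relation.TransGen D.Adj y z := by
    intro y z hyz
    obtain ⟨x, hxy, hxz⟩ := hcommon y z hyz
    refine not_transGen_of_finite hc (hfin x) (fun a ha b hb => ?_) hxy hxz
    obtain ⟨g, hgx, hga⟩ := het x a x b ha hb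
    refine ⟨g, hga, fun c hc => ?_⟩
    have := g.map_rel_iff.2 (show D.Adj x c from hc)
    rwa [hgx] at this
  have hsub : ∀ y z, D.delta y z → D.SameSink y z :=
    fun y z => hwdh.sameSink_of_delta hc hin hout hanti
  refine ⟨hsub, ?_⟩
  intro x
  obtain ⟨y₀, hxy₀, -⟩ := hout x x
  obtain ⟨φ⟩ := hS (x, y₀) hxy₀
  obtain ⟨_, γ, hinj, hγ⟩ := exists_coordinates_of_alternet_iso hc hin (by omega) hM hxy₀ φ
  obtain ⟨S₀⟩ := Subsets.nonempty hM
  obtain ⟨c₀, -⟩ : S₀.1.Nonempty := Finset.card_pos.1 (by rw [S₀.2]; omega)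
  have hδ : ∀ c, D.delta (γ (S₀, c₀)) (γ (S₀, c)) :=
    fun c => delta_iff.2 fun a => by rw [hγ, hγ]
  obtain ⟨w, hw⟩ := hin (γ (S₀, c₀))
  obtain ⟨φ'⟩ := hS (w, γ (S₀, c₀)) hw
  obtain ⟨β, γ', -, hγ'⟩ := exists_coordinates_of_alternet_iso hc hin (by omega) hM hw φ'
  have hi : Function.Injective fun c => β ⟨γ (S₀, c), hsub _ _ (hδ c)⟩ := by
    intro c d hcd
    exact (Prod.ext_iff.1 (hinj (Subtype.ext_iff.1 (β.injective hcd)))).2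
  -- These are m labels of vertices γ (S₀, c), seen as sinks of the alternet above them; they form
  -- the out-neighbourhood of a source.
  let S : Subsets m M := ⟨S₀.1.map ⟨_, hi⟩, by rw [Finset.card_map, S₀.2]⟩
  have key : ∀ y, D.Adj (γ' (S, c₀)) y → D.delta (γ (S₀, c₀)) y := by
    intro y hy
    obtain ⟨h1, h2⟩ := (hγ' _ _).1 hy
    obtain ⟨c, -, h3⟩ := Finset.mem_map.1 h2
    have h4 : γ (S₀, c) = y := Subtype.ext_iff.1 (β.injective h3)
    exact h4 ▸ hδ c
  intro y z hy hz
  obtain ⟨g, hg⟩ := hwdh.1 x (γ' (S, c₀))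
  have h1 := key _ (hg ▸ g.map_rel_iff.2 hy)
  have h2 := key _ (hg ▸ g.map_rel_iff.2 hz)
  exact (delta_map_iff g).1 (D.delta.trans (D.delta.symm h1) h2)

theorem delta_iff_sameSink {D : Digraph V} (h1 : ∀ y z, D.delta y z → D.SameSink y z)
    (h2 : ∀ x y z, D.Adj x y → D.Adj x z → D.delta y z) (y z : V) :
    D.delta y z ↔ D.SameSink y z := by
  refine ⟨h1 y z, fun h => ?_⟩
  induction h with
  | refl => exact D.delta.refl _
  | tail _ h ih =>
    obtain ⟨x, h3, h4⟩ := h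
    exact D.delta.trans ih (h2 _ _ _ h3 h4)

/-- A digraph whose `δ`-quotient is a tree, with coordinates in the `δ`-classes that turn the
out-neighbourhoods into all `m`-element subsets, comes from a labelled tree. -/
theorem exists_labelledTree_iso {D : Digraph V}
    (htree : (D.quotientBy D.delta).IsDirectedTree)
    (hval : ∀ A, ((D.quotientBy D.delta).outSet A).encard = 1)
    (hout : ∀ x, (D.outSet x).encard = m)
    (hone : ∀ x y z, D.Adj x y → D.Adj x z → D.delta y z)
    (hcoord : ∀ t : Quotient D.delta, ∃ β : {z // Quotient.mk D.delta z = t} ≃ Omega M,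
      ∀ S : Subsets m M, ∃ x, ∀ y, D.Adj x y ↔ ∃ h, β ⟨y, h⟩ ∈ S.1) (hm : 0 < m) :
    ∃ L : LabelledTree.{u} m M, Nonempty (D.Iso L.toDigraph) := by
  choose β γ hγ using hcoord
  have hadj : ∀ t S, (D.quotientBy D.delta).Adj (Quotient.mk _ (γ t S)) t := by
    intro t S
    obtain ⟨a, ha⟩ : S.1.Nonempty := Finset.card_pos.1 (by rw [S.2]; exact hm)
    refine ⟨γ t S, (β t).symm a, rfl, ((β t).symm a).2, (hγ t S _).2 ⟨((β t).symm a).2, ?_⟩⟩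
    simpa using ha
  -- An in-neighbour of `t` is a δ-class, hence amounts to its common out-neighbourhood, an
  -- m-element subset of the fibre over `t`.
  have hbij : ∀ t, Function.Bijective fun S : Subsets m M =>
      (⟨Quotient.mk _ (γ t S), hadj t S⟩ : (D.quotientBy D.delta).inSet t) := by
    intro t
    constructor
    · intro S S' h
      have h1 := delta_iff.1 (Quotient.exact (Subtype.ext_iff.1 h))
      refine Subtype.ext (Finset.ext fun a => ?_)
      have h2 := h1 ((β t).symm a)
      rw [hγ, hγ] at h2
      have h3 := ((β t).symm a).2
      simpa [h3] using h2
    · rintro ⟨B, hB⟩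
      induction B using Quotient.ind with | _ x
      have hfib : ∀ y, D.Adj x y → Quotient.mk D.delta y = t := by
        intro y hy
        induction t using Quotient.ind
        obtain ⟨z, h1, h2⟩ := quotientBy_delta_adj.1 hB
        exact Quotient.sound (D.delta.trans (hone _ _ _ hy h1) h2)
      have hcard : {a | D.Adj x ((β t).symm a)}.encard = m := by
        rw [← hout x, ← (Subtype.val_injective.comp (β t).symm.injective).encard_image]
        congr 1
        ext y
        constructor
        · rintro ⟨a, ha, rfl⟩
          exact ha
        · intro hy
          refine ⟨β t ⟨y, hfib y hy⟩, ?_, by simp⟩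
          change D.Adj x ((β t).symm (β t ⟨y, hfib y hy⟩))
          rwa [Equiv.symm_apply_apply]
      have hf : {a | D.Adj x ((β t).symm a)}.Finite := Set.finite_of_encard_eq_coe hcard
      refine ⟨⟨hf.toFinset, ?_⟩, Subtype.ext (Quotient.sound (delta_iff.2 fun y => ?_))⟩
      · rw [hf.encard_eq_coe_toFinset_card] at hcard
        exact_mod_cast hcard
      · rw [hγ]
        constructor
        · rintro ⟨h, h'⟩
          simpa using h'
        · intro hy
          exact ⟨hfib y hy, by simpa using hy⟩
  let L : LabelledTree.{u} m M :=
    { Vertex := Quotient D.delta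
      tree := D.quotientBy D.delta
      isTree := htree
      out_valency := hval
      label := fun t => (Equiv.ofBijective _ (hbij t)).symm }
  let f : V ≃ Quotient D.delta × Omega M :=
    (Equiv.sigmaFiberEquiv (Quotient.mk D.delta)).symm.trans
      ((Equiv.sigmaCongrRight β).trans (Equiv.sigmaEquivProd _ _))
  refine ⟨L, ⟨⟨f, ?_⟩⟩⟩
  intro x y
  have key : ∀ h : (D.quotientBy D.delta).Adj (Quotient.mk _ x) (Quotient.mk _ y),
      (β (Quotient.mk _ y) ⟨y, rfl⟩ ∈ (L.label (Quotient.mk _ y) ⟨Quotient.mk _ x, h⟩).1 ↔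
        D.Adj x y) := by
    intro h
    set S := L.label (Quotient.mk _ y) ⟨Quotient.mk _ x, h⟩ with hS
    have h1 : (⟨Quotient.mk _ (γ (Quotient.mk _ y) S), hadj _ S⟩ :
        (D.quotientBy D.delta).inSet (Quotient.mk _ y)) = ⟨Quotient.mk _ x, h⟩ :=
      Equiv.ofBijective_apply_symm_apply _ (hbij (Quotient.mk _ y)) _
    rw [← delta_iff.1 (Quotient.exact (Subtype.ext_iff.1 h1)) y, hγ]
    exact ⟨fun h => ⟨rfl, h⟩, fun h => h.2⟩
  change (∃ h : (D.quotientBy D.delta).Adj (Quotient.mk _ x) (Quotient.mk _ y),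
    β (Quotient.mk _ y) ⟨y, rfl⟩ ∈ (L.label (Quotient.mk _ y) ⟨Quotient.mk _ x, h⟩).1) ↔ _
  constructor
  · rintro ⟨h, h'⟩
    exact (key h).1 h'
  · intro h
    exact ⟨_, (key (quotientBy_delta_adj.2 ⟨y, h, D.delta.refl _⟩)).2 h⟩

theorem exists_class_coordinates {D : Digraph V} (hc : D.NoDirectedCycles)
    (hin : ∀ y, ∃ x, D.Adj x y) (hm : 0 < m) (hM : (m : ℕ∞) ≤ M)
    (hδ : ∀ y z, D.delta y z ↔ D.SameSink y z)
    (hS : ∀ e : V × V, D.Adj e.1 e.2 → Nonempty ((D.alternet e).Iso (SigmaDigraph m M)))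
    (t : Quotient D.delta) : ∃ β : {z // Quotient.mk D.delta z = t} ≃ Omega M,
      ∀ S : Subsets m M, ∃ x, ∀ y, D.Adj x y ↔ ∃ h, β ⟨y, h⟩ ∈ S.1 := by
  induction t using Quotient.ind with | _ y
  obtain ⟨x, hx⟩ := hin y
  obtain ⟨φ⟩ := hS (x, y) hx
  obtain ⟨β, γ, -, hγ⟩ := exists_coordinates_of_alternet_iso hc hin hm hM hx φ
  have hiff : ∀ z, Quotient.mk D.delta z = Quotient.mk D.delta y ↔ D.SameSink y z := by
    intro z
    rw [Quotient.eq, ← hδ]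
    exact ⟨D.delta.symm, D.delta.symm⟩
  -- The second coordinate of a source does not affect its out-neighbours, so any element of Ω
  -- serves.
  refine ⟨(Equiv.subtypeEquivRight hiff).trans β, fun S => ⟨γ (S, β ⟨y, .refl y⟩), fun z => ?_⟩⟩
  rw [hγ]
  exact ⟨fun ⟨h, h'⟩ => ⟨(hiff z).2 h, h'⟩, fun ⟨h, h'⟩ => ⟨(hiff z).1 h, h'⟩⟩

end Sigma

/-! ### Uniqueness of the labelled tree up to relabelling -/

section LabelledTree

variable {T : Type w} {I : Type v} {o : I}

theorem iterate_injective_of_no_cycles {next : T → T}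
    (hcyc : ∀ t k, next^[k] t = t → k = 0) (t : T) :
    Function.Injective fun n => next^[n] t := by
  have key : ∀ a b, a ≤ b → next^[a] t = next^[b] t → a = b := by
    intro a b hab h
    obtain ⟨d, rfl⟩ := Nat.exists_eq_add_of_le hab
    rw [Nat.add_comm, Function.iterate_add_apply] at h
    have := hcyc _ _ h.symm
    omega
  intro a b h
  rcases le_total a b with hab | hab
  · exact key a b hab h
  · exact (key b a hab h.symm).symm

theorem eq_of_iterate_eq {next : T → T} {lab : T → I}
    (hinj : ∀ s s', next s = next s' → lab s = lab s' → s = s') (a : ℕ) (s s' : T)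
    (h : next^[a] s = next^[a] s') (hl : ∀ i, lab (next^[i] s) = lab (next^[i] s')) : s = s' := by
  induction a generalizing s s' with
  | zero => exact h
  | succ a ih => exact hinj s s' (ih _ _ h fun i => hl (i + 1)) (hl 0)

/-- A labelled in-tree with a ray all of whose labels are `o` is isomorphic to the standard
one. -/
theorem exists_equiv_stdTree (next : T → T) (lab : T → I)
    (hinj : ∀ s s', next s = next s' → lab s = lab s' → s = s')
    (hsurj : ∀ t i, ∃ s, next s = t ∧ lab s = i)
    (hcyc : ∀ t k, next^[k] t = t → k = 0)
    (t₀ : T) (hconn : ∀ s, ∃ k n, next^[k] s = next^[n] t₀)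
    (hray : ∀ n, lab (next^[n] t₀) = o) :
    ∃ F : T ≃ StdTree I o, (∀ t, F (next t) = (F t).next) ∧
      ∀ t, (F t).path (F t).height = lab t := by
  choose K N hKN using hconn
  -- The height n - k is independent of where the path from `s` meets the ray, because there are no
  -- cycles; `t₀` has height 0.
  have huniq : ∀ s k n, next^[k] s = next^[n] t₀ → (n : ℤ) - k = N s - K s := by
    intro s k n h
    have h1 : next^[K s + n] t₀ = next^[k + N s] t₀ := by
      rw [Function.iterate_add_apply, ← h, Function.iterate_add_apply, ← hKN,
        ← Function.iterate_add_apply, ← Function.iterate_add_apply, Nat.add_comm]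
    have := iterate_injective_of_no_cycles hcyc t₀ h1
    omega
  -- The path of `s` records the labels met from `s` onwards; from height `N s` on it follows the
  -- ray and is constantly `o`.
  let F : T → StdTree I o := fun s =>
    { height := N s - K s
      path := fun j => if j < N s - K s then o else lab (next^[(j - (N s - K s)).toNat] s)
      below := fun j hj => if_pos hj
      eventually_eq := by
        refine ⟨N s, fun j hj => ?_⟩
        rw [if_neg (by omega)]
        obtain ⟨d, hd⟩ := Nat.exists_eq_add_of_le (show K s ≤ (j - (N s - K s)).toNat by omega)
        rw [hd, Nat.add_comm, Function.iterate_add_apply, hKN, ← Function.iterate_add_apply]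
        exact hray _ }
  have hpath : ∀ s (i : ℕ), (F s).path ((F s).height + i) = lab (next^[i] s) := by
    intro s i
    change (if _ then _ else _) = _
    rw [if_neg (by change ¬ (N s - K s : ℤ) + i < _; omega)]
    congr 2
    change ((N s - K s : ℤ) + i - (N s - K s)).toNat = i
    omega
  have hheight : ∀ s k n, next^[k] s = next^[n] t₀ → (F s).height = n - k :=
    fun s k n h => (huniq s k n h).symm
  have hnext : ∀ t, F (next t) = (F t).next := by
    intro t
    have hh : (F (next t)).height = (F t).height + 1 := by
      rw [hheight t _ _ (hKN t), hheight (next t) (K t) (N t + 1)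
        (by rw [← Function.iterate_succ_apply, Function.iterate_succ_apply', hKN,
          ← Function.iterate_succ_apply' next])]
      push_cast
      ring
    refine StdTree.ext' hh fun j hj => ?_
    obtain ⟨i, hi⟩ := Int.eq_ofNat_of_zero_le (sub_nonneg.2 hj)
    obtain rfl : j = (F (next t)).height + i := by omega
    simp only [StdTree.next]
    rw [hpath, if_neg (by omega), ← Function.iterate_succ_apply, ← hpath]
    congr 1
    push_cast
    omega
  have hlab : ∀ t, (F t).path (F t).height = lab t := fun t => by simpa using hpath t 0
  have hFinj : Function.Injective F := by
    intro s s' h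
    refine eq_of_iterate_eq hinj (K s + K s') s s' ?_ fun i => by rw [← hpath, ← hpath, h]
    have h1 := congrArg StdTree.height h
    rw [hheight s _ _ (hKN s), hheight s' _ _ (hKN s')] at h1
    rw [Function.iterate_add_apply next _ _ s', hKN, Nat.add_comm, Function.iterate_add_apply, hKN,
      ← Function.iterate_add_apply, ← Function.iterate_add_apply]
    congr 1
    omega
  have hFsurj : Function.Surjective F := by
    -- Far enough along, a standard path is the image of a ray vertex; `hsurj` then provides
    -- preimages one step back at a time.
    have hdesc : ∀ (k : ℕ) (p : StdTree I o), (∃ t, F t = StdTree.next^[k] p) → ∃ t, F t = p := by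
      intro k
      induction k with
      | zero => exact fun p h => h
      | succ k ih =>
        intro p h
        obtain ⟨w, hw⟩ := ih p.next h
        obtain ⟨s, hs, hs'⟩ := hsurj w (p.path p.height)
        have h1 : (stdTree I o).Adj (F s) p.next :=
          stdTree_adj_iff.2 (by rw [← hnext, hs, hw])
        have h2 : (stdTree I o).Adj p p.next := stdTree_adj_iff.2 rfl
        have h3 := h1.1
        have h4 := h2.1
        refine ⟨s, StdTree.ext' (by omega) fun j hj => ?_⟩
        rcases eq_or_lt_of_le hj with rfl | hj
        · rw [hlab, hs']
          congr 1
          omega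
        · rw [h1.2 j (by omega), h2.2 j (by omega)]
    intro p
    obtain ⟨n, hn⟩ := p.eventually_eq
    have hk : 0 ≤ p.height + ((max n 0 - p.height).toNat : ℤ) := by omega
    obtain ⟨a, ha⟩ := Int.eq_ofNat_of_zero_le hk
    refine hdesc (max n 0 - p.height).toNat p ⟨next^[a] t₀, ?_⟩
    have hh : (F (next^[a] t₀)).height = a := by
      rw [hheight (next^[a] t₀) 0 a rfl]
      simp
    refine StdTree.ext' ?_ fun j hj => ?_
    · rw [StdTree.iterate_height, hh, ha]
    · obtain ⟨i, hi⟩ := Int.eq_ofNat_of_zero_le (sub_nonneg.2 hj)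
      obtain rfl : j = (F (next^[a] t₀)).height + i := by omega
      rw [hpath, ← Function.iterate_add_apply, hray, StdTree.iterate_path _ _ _ (by omega),
        hn _ (by omega)]
  exact ⟨Equiv.ofBijective F ⟨hFinj, hFsurj⟩, hnext, hlab⟩

/-- For the least period, the rest of the cycle would join `next t` to `t` while avoiding the bridge
between them. -/
theorem IsDirectedTree.iterate_ne {G : Digraph T} (hG : G.IsDirectedTree) {next : T → T}
    (hnext : ∀ s t, G.Adj s t ↔ t = next s) (t : T) (k : ℕ) (h : next^[k] t = t) : k = 0 := by
  classical
  by_contra hk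
  have hex : ∃ k, 0 < k ∧ next^[k] t = t := ⟨k, Nat.pos_of_ne_zero hk, h⟩
  obtain ⟨hp, hpt⟩ := Nat.find_spec hex
  set p := Nat.find hex
  obtain ⟨hloop, hasymm, -, hacyc⟩ := hG
  have hadj : ∀ s, G.toSimpleGraphInclusive.Adj s (next s) := by
    intro s
    have hs : G.Adj s (next s) := (hnext _ _).2 rfl
    exact (SimpleGraph.fromRel_adj _ _ _).2
      ⟨fun h => hloop s (by rw [← h] at hs; exact hs), Or.inl hs⟩
  have hbr := (SimpleGraph.isBridge_iff).1
    (SimpleGraph.isAcyclic_iff_forall_adj_isBridge.1 hacyc (hadj t))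
  have hr : ∀ i, i < p → (G.toSimpleGraphInclusive.deleteEdges {s(t, next t)}).Reachable
      (next t) (next^[i + 1] t) := by
    intro i
    induction i with
    | zero => exact fun _ => SimpleGraph.Reachable.refl _
    | succ i ih =>
      intro hi
      refine (ih (by omega)).trans (SimpleGraph.Adj.reachable ?_)
      rw [SimpleGraph.deleteEdges_adj, Function.iterate_succ_apply' next (i + 1)]
      refine ⟨hadj _, fun hmem => ?_⟩
      rcases Sym2.eq_iff.1 (Set.mem_singleton_iff.1 hmem) with ⟨h1, -⟩ | ⟨h1, h2⟩
      · exact Nat.find_min hex hi ⟨by omega, h1⟩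
      · rw [h1] at h2
        exact hasymm t (next t) ((hnext _ _).2 rfl) ((hnext _ _).2 h2.symm)
  have := hr (p - 1) (by omega)
  rw [Nat.sub_add_cancel hp, hpt] at this
  exact hbr this.symm

theorem IsConnected.exists_iterate_eq {G : Digraph T} (hG : G.IsConnected) {next : T → T}
    (hnext : ∀ s t, G.Adj s t ↔ t = next s) (s t : T) : ∃ k n, next^[k] s = next^[n] t := by
  obtain ⟨w⟩ := ((SimpleGraph.connected_iff _).1 hG).1 s t
  induction w with
  | nil => exact ⟨0, 0, rfl⟩
  | @cons a c b hac _ ih =>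
    obtain ⟨k, n, h⟩ := ih
    rcases ((SimpleGraph.fromRel_adj _ _ _).1 hac).2 with h' | h'
    · rw [hnext] at h'
      exact ⟨k + 1, n, by rw [Function.iterate_succ_apply, ← h', h]⟩
    · rw [hnext] at h'
      refine ⟨k, n + 1, ?_⟩
      rw [h', ← Function.iterate_succ_apply, Function.iterate_succ_apply', h,
        ← Function.iterate_succ_apply' next]

variable {m : ℕ} {M : ℕ∞}

theorem exists_perm_map_eq {α : Type*} (S S' : Finset α) (h : S.card = S'.card) :
    ∃ π : Equiv.Perm α, S.map π.toEmbedding = S' := by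
  classical
  let x : Fin S.card ↪ α := S.equivFin.symm.toEmbedding.trans (Function.Embedding.subtype _)
  let y : Fin S.card ↪ α :=
    (S'.equivFinOfCardEq h.symm).symm.toEmbedding.trans (Function.Embedding.subtype _)
  -- The symmetric group is transitive on injective tuples of a given finite length, even on an
  -- infinite set.
  obtain ⟨g, hg⟩ := (Equiv.Perm.isMultiplyPretransitive α S.card).exists_smul_eq x y
  refine ⟨g, Finset.eq_of_subset_of_card_le (fun a ha => ?_) (by simp [h])⟩
  obtain ⟨b, hb, rfl⟩ := Finset.mem_map.1 ha
  have := DFunLike.congr_fun hg (S.equivFin ⟨b, hb⟩)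
  simp only [Function.Embedding.smul_apply, x, y, Function.Embedding.trans_apply,
    Equiv.coe_toEmbedding, Equiv.symm_apply_apply, Function.Embedding.subtype_apply] at this
  change g b ∈ S'
  change g b = _ at this
  rw [this]
  exact Subtype.prop _

/-- The labelled tree on the standard tree. -/
def stdLabelledTree (o : Subsets m M) : LabelledTree.{0} m M where
  Vertex := StdTree (Subsets m M) o
  tree := stdTree _ _
  isTree := stdTree_isDirectedTree
  out_valency t := by rw [stdTree_outSet]; simp
  label t := stdLabel t

/-- The digraph `D(m, M)` does not depend on the labelled tree. -/
theorem LabelledTree.nonempty_iso_std (L : LabelledTree.{w} m M) (o : Subsets m M) :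
    Nonempty (L.toDigraph.Iso (stdLabelledTree o).toDigraph) := by
  choose next hnext' using fun t => Set.encard_eq_one.1 (L.out_valency t)
  have hnext : ∀ s t, L.tree.Adj s t ↔ t = next s := fun s t => by
    change t ∈ L.tree.outSet s ↔ _
    rw [hnext' s]
    rfl
  let lab : L.Vertex → Subsets m M := fun s => L.label (next s) ⟨s, (hnext _ _).2 rfl⟩
  have hlab : ∀ s t (h : s ∈ L.tree.inSet t), L.label t ⟨s, h⟩ = lab s := by
    intro s t h
    obtain rfl := (hnext s t).1 h
    rfl
  obtain ⟨t₀⟩ := L.isTree.2.2.1.nonempty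
  have hcyc := L.isTree.iterate_ne hnext
  -- At most one ray vertex precedes `t` on the ray, so one permutation of the fibre suffices to
  -- make its label `o`.
  have hπ : ∀ t, ∃ π : Equiv.Perm (Omega M),
      ∀ n, next^[n + 1] t₀ = t → (lab (next^[n] t₀)).1.map π.toEmbedding = o.1 := by
    intro t
    by_cases h : ∃ n, next^[n + 1] t₀ = t
    · obtain ⟨n, hn⟩ := h
      obtain ⟨π, hπ⟩ := exists_perm_map_eq (lab (next^[n] t₀)).1 o.1
        ((lab (next^[n] t₀)).2.trans o.2.symm)
      refine ⟨π, fun k hk => ?_⟩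
      have := iterate_injective_of_no_cycles hcyc t₀ (hk.trans hn.symm)
      obtain rfl : k = n := by omega
      exact hπ
    · exact ⟨1, fun n hn => absurd ⟨n, hn⟩ h⟩
  choose π hπ using hπ
  let lab' : L.Vertex → Subsets m M :=
    fun s => ⟨(lab s).1.map (π (next s)).toEmbedding, by rw [Finset.card_map, (lab s).2]⟩
  obtain ⟨F, hF, hF'⟩ := exists_equiv_stdTree (o := o) next lab'
    (by
      intro s s' h h'
      have h1 : lab s = lab s' := by
        refine Subtype.ext (Finset.map_injective (π (next s)).toEmbedding ?_)
        have := Subtype.ext_iff.1 h'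
        simp only [lab'] at this
        rw [this, h]
      have h2 : L.label (next s) ⟨s, (hnext _ _).2 rfl⟩ =
          L.label (next s) ⟨s', (hnext _ _).2 h⟩ := h1.trans (hlab _ _ _).symm
      exact Subtype.ext_iff.1 ((L.label (next s)).injective h2))
    (by
      intro t S
      let S' : Subsets m M := ⟨S.1.map (π t).symm.toEmbedding, by rw [Finset.card_map, S.2]⟩
      obtain ⟨s, hs⟩ := (L.label t).surjective S'
      obtain ⟨s, hst⟩ := s
      have h1 := (hnext s t).1 hst
      refine ⟨s, h1.symm, Subtype.ext ?_⟩
      simp only [lab']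
      rw [← h1, ← hlab s t hst, hs]
      ext a
      simp [S'])
    hcyc t₀ (fun s => IsConnected.exists_iterate_eq L.isTree.2.2.1 hnext s t₀)
    (fun n => Subtype.ext (by
      simp only [lab']
      rw [← Function.iterate_succ_apply' next]
      exact hπ _ n rfl))
  -- Twisting the fibre over `t` by `π t` replaces the labels `lab` by `lab'`.
  let f : L.Vertex × Omega M ≃ StdTree (Subsets m M) o × Omega M :=
    { toFun := fun x => (F x.1, π x.1 x.2)
      invFun := fun y => (F.symm y.1, (π (F.symm y.1)).symm y.2)
      left_inv := fun x => by simp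
      right_inv := fun y => by simp }
  refine ⟨⟨f, ?_⟩⟩
  rintro ⟨s, c⟩ ⟨t, a⟩
  have h1 : L.toDigraph.Adj (s, c) (t, a) ↔ t = next s ∧ a ∈ (lab s).1 := by
    constructor
    · rintro ⟨h, h'⟩
      rw [hlab] at h'
      exact ⟨(hnext _ _).1 h, h'⟩
    · rintro ⟨h, h'⟩
      exact ⟨(hnext _ _).2 h, (congrArg (a ∈ ·.1) (hlab s t _)).mpr h'⟩
  have h2 : (stdLabelledTree o).toDigraph.Adj (F s, π s c) (F t, π t a) ↔
      F t = (F s).next ∧ π t a ∈ (lab' s).1 := by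
    rw [← hF' s]
    exact ⟨fun ⟨h, h'⟩ => ⟨stdTree_adj_iff.1 h, h'⟩, fun ⟨h, h'⟩ => ⟨stdTree_adj_iff.2 h, h'⟩⟩
  change (stdLabelledTree o).toDigraph.Adj (F s, π s c) (F t, π t a) ↔ L.toDigraph.Adj (s, c) (t, a)
  rw [h1, h2, ← hF, F.injective.eq_iff]
  refine and_congr_right fun h => ?_
  subst h
  simp [lab']

end LabelledTree

end Digraph

/-! ### The theorem -/

theorem theorem5 {V : Type u} (D : Digraph V) (m : ℕ) (hm : 1 < m)
    (hconn : D.IsConnected)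
    (hout : ∀ x, (D.outSet x).encard = (m : ℕ∞))
    (hcyc : D.NoDirectedCycles)
    (hdt : D.IsDistanceTransitive)
    (hwdh : D.IsWeaklyDescendantHomogeneous)
    (hreach : ¬ D.ReachabilityUniversal) :
    ((∀ e : V × V, D.Adj e.1 e.2 → (D.alternet e).InClassC) →
      (∃ x y : V, x ≠ y ∧ D.delta x y) ∧
      (D.quotientBy D.delta).IsDirectedTree ∧
      (∀ A, ((D.quotientBy D.delta).outSet A).encard = 1) ∧
      (∀ e : V × V, D.Adj e.1 e.2 → ∀ A,
        ((D.quotientBy D.delta).inSet A).encard = (D.alternet e).numDeltaClasses)) ∧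
    (∀ M : ℕ∞, (m : ℕ∞) ≤ M →
      (∀ e : V × V, D.Adj e.1 e.2 →
        Nonempty ((D.alternet e).Iso (Digraph.SigmaDigraph m M))) →
      ∀ L : Digraph.LabelledTree.{w} m M, Nonempty (D.Iso L.toDigraph)) := by
  have hout' : ∀ x y, ∃ z, D.Adj x z ∧ z ≠ y := by
    intro x y
    have h : 1 < (D.outSet x).encard := by
      rw [hout]
      exact_mod_cast hm
    exact Set.exists_ne_of_one_lt_encard h y
  have hout₁ : ∀ x, ∃ y, D.Adj x y := fun x => (hout' x x).imp fun _ h => h.1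
  have hin := Digraph.exists_in_neighbour hwdh.1 hout₁
  constructor
  · intro hC
    obtain ⟨x⟩ := ((SimpleGraph.connected_iff _).1 hconn).2
    obtain ⟨y, hxy⟩ := hout₁ x
    have hδ := hwdh.delta_iff_sameSink_of_inClassC hcyc hout' (e := (x, y)) hxy (hC (x, y) hxy)
    have hone : ∀ x y z, D.Adj x y → D.Adj x z → D.delta y z :=
      fun x y z h h' => (hδ y z).2 (Digraph.SameSink.of_adj h h')
    exact ⟨Digraph.exists_delta_of_inClassC hcyc (e := (x, y)) hxy (hC (x, y) hxy),
      Digraph.isDirectedTree_quotientBy_delta hcyc hconn hone,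
      Digraph.encard_outSet_quotientBy_delta hout₁ hone,
      fun e he A => Digraph.encard_inSet_quotientBy_delta hcyc hwdh.1 hδ he A⟩
  · intro M hM hS L
    obtain ⟨hsub, hone⟩ := hwdh.delta_of_alternet_iso hcyc (hdt.isEdgeTransitive hcyc) hm hM
      (fun x => Set.finite_of_encard_eq_coe (hout x)) hout' hS
    -- The tree obtained from D and the given one may live in different universes; both are compared
    -- with the standard one.
    obtain ⟨L', ⟨φ⟩⟩ := Digraph.exists_labelledTree_iso
      (Digraph.isDirectedTree_quotientBy_delta hcyc hconn hone)
      (Digraph.encard_outSet_quotientBy_delta hout₁ hone) hout hone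
      (Digraph.exists_class_coordinates hcyc hin (by omega) hM
        (Digraph.delta_iff_sameSink hsub hone) hS) (by omega)
    obtain ⟨o⟩ := Digraph.Subsets.nonempty hM
    obtain ⟨ψ'⟩ := L'.nonempty_iso_std o
    obtain ⟨ψ⟩ := L.nonempty_iso_std o
    exact ⟨(φ.trans ψ').trans ψ.symm⟩
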